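/- Let $z,z'\in\mathbb C$ be such that $(z)_k(z')_k$ and $(-z)_k(-z')_k$ are real and strictly positive for all $k=1,2,\dots$, where $(a)_k=a(a+1)\cdots(a+k-1)$, $(a)_0=1$. Put $t=zz'>0$ and let $0<\xi<1$. For a Young diagram $\lambda$ with $n=|\lambda|$ boxes and Frobenius coordinates $(p_1,\dots,p_d\,|\,q_1,\dots,q_d)$ (here $d$ is the number of diagonal boxes, $p_i$ the number of boxes in the $i$-th row to the right of the $i$-th diagonal box, $q_i$ the number of boxes in the $i$-th column below it), let $$M_{z,z'}(\lambda)=\frac{n!}{(t)_n}\,t^d\prod_{i=1}^d\frac{(z+1)_{p_i}(z'+1)_{p_i}(-z+1)_{q_i}(-z'+1)_{q_i}}{p_i!^2\,q_i!^2}\;{\det}^2\Bigl[\frac1{p_i+q_j+1}\Bigr]_{1\le i,j\le d},$$ and let $$M_{z,z',\xi}(\lambda)=M_{z,z'}(\lambda)\,(1-\xi)^t\,\frac{(t)_n}{n!}\,\xi^n,\qquad n=|\lambda|.$$ Let $\mathcal P_{z,z',\xi}$ be the image of $M_{z,z',\xi}$ under the map $$\lambda\mapsto\{p_1+\tfrac12,\dots,p_d+\tfrac12,-q_1-\tfrac12,\dots,-q_d-\tfrac12\}$$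 from Young diagrams to finite subsets of $\mathbb Z'=\mathbb Z+\frac12$, and let $\pi(X)$ be the mass that it gives to a finite set $X\subset\mathbb Z'$. Identify the positive and the negative half-integers with $\mathbb Z_+=\{0,1,2,\dots\}$ via $\pm(k+\frac12)\leftrightarrow k$, so that $\ell^2(\mathbb Z')=\ell^2(\mathbb Z_+)\oplus\ell^2(\mathbb Z_+)$. Let $$\Psi_\pm=\operatorname{diag}\left\{\frac{t^{1/2}\xi^{k+1/2}(1-\xi)^{\pm(z+z')}(1\pm z)_k(1\pm z')_k}{k!\,k!}\right\}_{k\in\mathbb Z_+},\qquad W(k,l)=\frac1{k+l+1},$$ where the diagonal entries of $\Psi_\pm$ are real and positive and $\Psi_\pm^{1/2}$ is the positive square root. **Proposition.** $\mathcal P_{z,z',\xi}$ is a point process (that is, $\pi\ge0$ and $\sum_X\pi(X)=1$), and it is the determinantal process determined by the operator $$L=\begin{bmatrix}0&\Psi_+^{1/2}W\Psi_-^{1/2}\\-\Psi_-^{1/2}W\Psi_+^{1/2}&0\end{bmatrix}$$ on $\ell^2(\mathbb Z')$. In detail: this matrix defines a trace class operator $L$ whose principal minors $\det L_X$ ($X\subset\mathbb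 Z'$ finite, $\det L_\varnothing=1$) are real and nonnegative; the Fredholm determinant $\det(1+L)=\sum_{n\ge0}\operatorname{tr}(\wedge^nL)=\sum_X\det L_X$ is nonzero; and for every finite $X\subset\mathbb Z'$ $$\pi(X)=\frac{\det L_X}{\det(1+L)}.$$ Moreover, $\det(1+L)=(1-\xi)^{-t}$. -/

import Mathlib

open scoped Nat lp

noncomputable section

/-! ### The parameters -/

/-- The Pochhammer symbol `(a)_k = a (a+1) ⋯ (a+k-1)`, `(a)_0 = 1`, for complex `a`. -/
def poch (a : ℂ) (k : ℕ) : ℂ := (ascPochhammer ℂ k).eval a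

/-- The standing assumption on the parameters: `(z)_k (w)_k` and `(-z)_k (-w)_k` are real and
strictly positive for all `k = 1, 2, …`. -/
def AdmissibleParams (z w : ℂ) : Prop :=
  ∀ k : ℕ, 1 ≤ k →
    ((poch z k * poch w k).im = 0 ∧ 0 < (poch z k * poch w k).re) ∧
    ((poch (-z) k * poch (-w) k).im = 0 ∧ 0 < (poch (-z) k * poch (-w) k).re)

/-- The parameter `t = z w`, a real number by `AdmissibleParams.mul_im`. -/
def tParam (z w : ℂ) : ℝ := (z * w).re

/-- The number `(z+1)_k (w+1)_k`, real by `AdmissibleParams.poch_succ_im`. -/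
def pochPair (z w : ℂ) (k : ℕ) : ℝ := (poch (z + 1) k * poch (w + 1) k).re

/-! The next facts show that no information is lost by the real parts taken in `tParam`,
`pochPair` and in the exponent of `psiWeight`. -/

theorem AdmissibleParams.neg {z w : ℂ} (h : AdmissibleParams z w) :
    AdmissibleParams (-z) (-w) := by
  intro k hk
  have := h k hk
  simpa only [neg_neg] using this.symm

theorem AdmissibleParams.mul_im {z w : ℂ} (h : AdmissibleParams z w) : (z * w).im = 0 := by
  have := (h 1 le_rfl).1.1
  simpa [poch] using this

theorem AdmissibleParams.tParam_pos {z w : ℂ} (h : AdmissibleParams z w) : 0 < tParam z w := by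
  have := (h 1 le_rfl).1.2
  simpa [poch, tParam] using this

theorem AdmissibleParams.coe_tParam {z w : ℂ} (h : AdmissibleParams z w) :
    ((tParam z w : ℝ) : ℂ) = z * w :=
  Complex.ext (by simp [tParam]) (by rw [h.mul_im, Complex.ofReal_im])

theorem poch_succ (z : ℂ) (k : ℕ) : poch z (k + 1) = z * poch (z + 1) k := by
  simp [poch, ascPochhammer_succ_left, Polynomial.eval_comp]

theorem AdmissibleParams.poch_succ_aux {z w : ℂ} (h : AdmissibleParams z w) (k : ℕ) :
    (poch (z + 1) k * poch (w + 1) k).im = 0 ∧ 0 < (poch (z + 1) k * poch (w + 1) k).re := by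
  have h1 := (h (k + 1) (by omega)).1
  have e : poch z (k + 1) * poch w (k + 1)
      = (tParam z w : ℂ) * (poch (z + 1) k * poch (w + 1) k) := by
    rw [h.coe_tParam, poch_succ, poch_succ]; ring
  rw [e, Complex.im_ofReal_mul, Complex.re_ofReal_mul] at h1
  have ht := h.tParam_pos
  exact ⟨by simpa [ht.ne'] using h1.1, (mul_pos_iff_of_pos_left ht).1 h1.2⟩

theorem AdmissibleParams.poch_succ_im {z w : ℂ} (h : AdmissibleParams z w) (k : ℕ) :
    (poch (z + 1) k * poch (w + 1) k).im = 0 := (h.poch_succ_aux k).1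

theorem AdmissibleParams.pochPair_pos {z w : ℂ} (h : AdmissibleParams z w) (k : ℕ) :
    0 < pochPair z w k := (h.poch_succ_aux k).2

theorem AdmissibleParams.add_im {z w : ℂ} (h : AdmissibleParams z w) : (z + w).im = 0 := by
  have h1 := h.poch_succ_im 1
  have e : poch (z + 1) 1 * poch (w + 1) 1 = z * w + (z + w) + 1 := by
    simp [poch]; ring
  rw [e, Complex.add_im, Complex.add_im, h.mul_im] at h1
  simpa using h1

/-! ### Frobenius coordinates and the mixed z-measure on Young diagrams -/

/-- The number `d` of diagonal boxes of a Young diagram. -/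
def diagLen (μ : YoungDiagram) : ℕ := (μ.cells.filter fun c => c.1 = c.2).card

/-- The Frobenius coordinate `p_i`: the number of boxes in row `i` to the right of the diagonal
box `(i, i)` (rows and columns are numbered from `0`). -/
def frobP (μ : YoungDiagram) (i : Fin (diagLen μ)) : ℕ := μ.rowLen i - (i + 1)

/-- The Frobenius coordinate `q_i`: the number of boxes in column `i` below the diagonal
box `(i, i)`. -/
def frobQ (μ : YoungDiagram) (i : Fin (diagLen μ)) : ℕ := μ.colLen i - (i + 1)

/-- The z-measure
`n! / (t)_n * t^d * ∏ i, (z+1)_{p_i} (w+1)_{p_i} (-z+1)_{q_i} (-w+1)_{q_i} / (p_i!² q_i!²)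
  * det [1 / (p_i + q_j + 1)] ^ 2`
on Young diagrams with `n = |μ|` boxes. -/
def zMeasure (z w : ℂ) (μ : YoungDiagram) : ℝ :=
  (μ.card ! : ℝ) / (ascPochhammer ℝ μ.card).eval (tParam z w) * tParam z w ^ diagLen μ *
    (∏ i : Fin (diagLen μ), pochPair z w (frobP μ i) * pochPair (-z) (-w) (frobQ μ i) /
      (((frobP μ i)! : ℝ) ^ 2 * ((frobQ μ i)! : ℝ) ^ 2)) *
    (Matrix.of fun i j : Fin (diagLen μ) =>
      (1 : ℝ) / ((frobP μ i : ℝ) + (frobQ μ j : ℝ) + 1)).det ^ 2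

/-- The negative binomial distribution `(1-ξ)^t (t)_n / n! ξ^n`. -/
def negBinomial (t ξ : ℝ) (n : ℕ) : ℝ :=
  (1 - ξ) ^ t * ((ascPochhammer ℝ n).eval t / (n ! : ℝ)) * ξ ^ n

/-- The z-measures mixed by the negative binomial distribution of the number of boxes. -/
def mixedZMeasure (z w : ℂ) (ξ : ℝ) (μ : YoungDiagram) : ℝ :=
  zMeasure z w μ * negBinomial (tParam z w) ξ μ.card

/-! ### Half-integers and configurations -/

/-- The lattice `ℤ + 1/2` of half-integers. -/
abbrev HalfInt : Type := {x : ℚ // ∃ n : ℤ, x = n + 1 / 2}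

/-- The half-integer `k + 1/2`. -/
def posHalf (k : ℕ) : HalfInt := ⟨k + 1 / 2, k, by simp⟩

/-- The half-integer `-k - 1/2`. -/
def negHalf (k : ℕ) : HalfInt := ⟨-k - 1 / 2, -k - 1, by push_cast; ring⟩

/-- The identification of `ℕ ⊔ ℕ` with the half-integers, `k ↦ k + 1/2` on the first copy and
`k ↦ -(k + 1/2)` on the second one. -/
def halfIntEquiv : ℕ ⊕ ℕ ≃ HalfInt :=
  Equiv.ofBijective (Sum.elim posHalf negHalf) (by
    constructor
    · rintro (a | a) (b | b) h
      · have h' := congrArg Subtype.val h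
        simp only [Sum.elim_inl, posHalf, add_left_inj, Nat.cast_inj] at h'
        rw [h']
      · have h' := congrArg Subtype.val h
        simp only [Sum.elim_inl, Sum.elim_inr, posHalf, negHalf] at h'
        have ha : (0 : ℚ) ≤ a := a.cast_nonneg
        have hb : (0 : ℚ) ≤ b := b.cast_nonneg
        linarith
      · have h' := congrArg Subtype.val h
        simp only [Sum.elim_inl, Sum.elim_inr, posHalf, negHalf] at h'
        have ha : (0 : ℚ) ≤ a := a.cast_nonneg
        have hb : (0 : ℚ) ≤ b := b.cast_nonneg
        linarith
      · have h' := congrArg Subtype.val h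
        simp only [Sum.elim_inr, negHalf, sub_left_inj, neg_inj, Nat.cast_inj] at h'
        rw [h']
    · rintro ⟨x, n, rfl⟩
      rcases le_or_gt 0 n with hn | hn
      · refine ⟨Sum.inl n.toNat, Subtype.ext ?_⟩
        have : ((n.toNat : ℤ) : ℚ) = n := by rw [Int.toNat_of_nonneg hn]
        simp only [Sum.elim_inl, posHalf]
        rw [Int.cast_natCast] at this
        rw [this]
      · refine ⟨Sum.inr (-n - 1).toNat, Subtype.ext ?_⟩
        have : (((-n - 1).toNat : ℤ) : ℚ) = ((-n - 1 : ℤ) : ℚ) := by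
          rw [Int.toNat_of_nonneg (by omega)]
        simp only [Sum.elim_inr, negHalf]
        rw [Int.cast_natCast] at this
        rw [this]; push_cast; ring)

/-- The configuration `{p_1 + 1/2, …, p_d + 1/2, -q_1 - 1/2, …, -q_d - 1/2}` of a diagram. -/
def frobConf (μ : YoungDiagram) : Finset HalfInt :=
  (Finset.univ.image fun i => posHalf (frobP μ i)) ∪
    (Finset.univ.image fun i => negHalf (frobQ μ i))

/-- The law of the point process on the half-integers: the image of the mixed z-measure
under `frobConf`, as a function on configurations. -/
def zMeasureProcess (z w : ℂ) (ξ : ℝ) (X : Finset HalfInt) : ℝ :=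
  ∑' μ : {μ : YoungDiagram // frobConf μ = X}, mixedZMeasure z w ξ μ

/-! ### Determinantal point processes -/

section Determinantal

variable {S : Type*} [DecidableEq S]

/-- A point process on `S` with finite configurations, given by its law `π`. -/
def IsPointProcess (π : Finset S → ℝ) : Prop :=
  (∀ X, 0 ≤ π X) ∧ HasSum π 1

/-- The matrix entry `L(x, y)` of an operator on `ℓ²(S)`: the `x`-th coordinate of the image
of the basis vector `e_y`. -/
def opEntry (L : ℓ²(S, ℂ) →L[ℂ] ℓ²(S, ℂ)) (x y : S) : ℂ :=
  (L (lp.single 2 y (1 : ℂ)) : ℓ²(S, ℂ)) x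

/-- The principal minor `det L_X`; it equals `1` for empty `X`. -/
def opMinor (L : ℓ²(S, ℂ) →L[ℂ] ℓ²(S, ℂ)) (X : Finset S) : ℂ :=
  (Matrix.of fun x y : X => opEntry L x y).det

/-- `L` is a trace class (nuclear) operator: `L = ∑ n, ⟨v_n, ·⟩ u_n` with
`∑ n, ‖u_n‖ ‖v_n‖ < ∞`. -/
def IsTraceClass (L : ℓ²(S, ℂ) →L[ℂ] ℓ²(S, ℂ)) : Prop :=
  ∃ u v : ℕ → ℓ²(S, ℂ), (Summable fun n => ‖u n‖ * ‖v n‖) ∧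
    ∀ f, HasSum (fun n => inner ℂ (v n) f • u n) (L f)

/-- The trace of the `n`-th exterior power of `L`, computed in the orthonormal basis
`e_X = e_{x_1} ∧ … ∧ e_{x_n}`, `X = {x_1, …, x_n}`, where the diagonal entry
at `e_X` is `det L_X`. -/
def trExteriorPower (L : ℓ²(S, ℂ) →L[ℂ] ℓ²(S, ℂ)) (n : ℕ) : ℂ :=
  ∑' X : {X : Finset S // X.card = n}, opMinor L X

/-- The Fredholm determinant `det (1 + L) = ∑ n, tr (Λⁿ L)` of a trace class operator. -/
def fredholmDet (L : ℓ²(S, ℂ) →L[ℂ] ℓ²(S, ℂ)) : ℂ := ∑' n : ℕ, trExteriorPower L n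

/-- `π` is the law of the determinantal point process determined by the operator `L`: `L` is
trace class, its principal minors are real and nonnegative, `det (1 + L)` (the convergent sum
of these minors) is nonzero, and `π(X) = det L_X / det (1 + L)`. -/
def IsDeterminantalProcess (π : Finset S → ℝ) (L : ℓ²(S, ℂ) →L[ℂ] ℓ²(S, ℂ)) : Prop :=
  IsPointProcess π ∧ IsTraceClass L ∧
    (∀ X, (opMinor L X).im = 0 ∧ 0 ≤ (opMinor L X).re) ∧
    HasSum (opMinor L) (fredholmDet L) ∧ fredholmDet L ≠ 0 ∧
    ∀ X, (π X : ℂ) = opMinor L X / fredholmDet L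

end Determinantal

/-! ### The matrix of the operator -/

/-- The `k`-th diagonal entry of `Ψ₊`,
`t^{1/2} ξ^{k+1/2} (1-ξ)^{z+w} (1+z)_k (1+w)_k / (k! k!)`.
The entries of `Ψ₋` are obtained by replacing `(z, w)` by `(-z, -w)`. -/
def psiWeight (z w : ℂ) (ξ : ℝ) (k : ℕ) : ℝ :=
  Real.sqrt (tParam z w) * ξ ^ ((k : ℝ) + 1 / 2) * (1 - ξ) ^ (z + w).re * pochPair z w k /
    ((k ! : ℝ) * (k ! : ℝ))

/-- The matrix `W(k, l) = 1 / (k + l + 1)`. -/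
def wMatrix : Matrix ℕ ℕ ℝ := Matrix.of fun k l => 1 / ((k : ℝ) + (l : ℝ) + 1)

/-- The matrix `Ψ₊^{1/2} W Ψ₋^{1/2}`. For `(-z, -w)` in place of `(z, w)` it is the matrix
`Ψ₋^{1/2} W Ψ₊^{1/2}`. -/
def psiWpsi (z w : ℂ) (ξ : ℝ) : Matrix ℕ ℕ ℝ := Matrix.of fun k l =>
  Real.sqrt (psiWeight z w ξ k) * wMatrix k l * Real.sqrt (psiWeight (-z) (-w) ξ l)

/-- The matrix `[[0, Ψ₊^{1/2} W Ψ₋^{1/2}], [-Ψ₋^{1/2} W Ψ₊^{1/2}, 0]]`, with rows and columns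
indexed by the half-integers; the first block corresponds to the positive ones. -/
def zLMatrix (z w : ℂ) (ξ : ℝ) : Matrix HalfInt HalfInt ℝ :=
  Matrix.reindex halfIntEquiv halfIntEquiv
    (Matrix.fromBlocks 0 (psiWpsi z w ξ) (-psiWpsi (-z) (-w) ξ) 0)

end

/-!
The principal minor of `L` at a configuration `X` vanishes unless `X` has as many positive as
negative points, and for `X = {p_i + 1/2} ∪ {-q_j - 1/2}` with `d` points of each sign it is
`t ^ d ∏ (z+1)_{p_i} (w+1)_{p_i} (-z+1)_{q_i} (-w+1)_{q_i} / (p_i! q_i!)² det [1/(p_i+q_j+1)]²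
ξ ^ ∑ (p_i+q_i+1)`, because the block matrix `[[0, A], [-Aᵀ, 0]]` has determinant `(det A)²`
(`AdmissibleParams.zLMinor_pairConf`). As Frobenius coordinates are a bijection between Young
diagrams and balanced configurations (`frobConf_injective`, `exists_frobConf_eq`), with
`|λ| = ∑ (p_i + q_i + 1)` (`card_eq_sum_frob`), this minor is `(1 - ξ)^{-t} M_{z,z',ξ}(λ)`.

What is left is the normalization `∑_X det L_X = (1 - ξ)^{-t}`. Put
`g(p, q) = 1 / ((p + q + 1) p! q!)` and `G(p, q) = det [g(p_i, q_j)]`, for arbitrary `d`-tuples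
`p, q` of natural numbers; for Frobenius coordinates `G` is `dim λ / |λ|!`. Two identities for the
entries,

* `g(p - 1, q) + g(p, q - 1) = (p + q + 1) g(p, q) - δ_{p0} δ_{q0}`,
* `(P² + sP + t) g(p + 1, q) + (Q² - sQ + t) g(p, q + 1) = (p + q + 1) g(p, q) + t g(p, 0) g(0, q)`
  with `P = p + 1`, `Q = q + 1`, `s = z + w`,

give, on taking the derivative of the determinant, a rule for removing a box (`hookDet_down`)
and one for adding a box (`hookDet_up`). They express `(d + ∑ (p_i + q_i)) G` and
`(t + d + ∑ (p_i + q_i)) G` through the values of `G` at the neighbours in the Young graph. Let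
`S_n` be the sum of the coefficients of `ξ ^ n`. Counting edges of the Young graph between the
levels `n` and `n + 1` in two ways yields `(n + 1) S_{n+1} = (t + n) S_n`, so that
`S_n = (t)_n / n!` (`sum_levelSum`), and the binomial series finishes the computation.

All sums run over tuples instead of sets: the summands are symmetric under permutations of the
`p_i` and of the `q_j` and vanish when two coordinates agree, so each configuration is counted
`(d!)²` times (`hasSum_of_hasSum_tuple`).

The operator itself is the sum of the rank one operators `L(x, y) ⟨e_y, ·⟩ e_x`; its entries are
absolutely summable because `∑ √Ψ±(k)` converges.
-/

noncomputable section

open Matrix Finset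

/-! ### Determinants and adjugates -/

theorem det_updateRow_eq_sum_adjugate {ι R : Type*} [Fintype ι] [DecidableEq ι] [CommRing R]
    (A : Matrix ι ι R) (i : ι) (b : ι → R) :
    (A.updateRow i b).det = ∑ j, b j * A.adjugate j i := by
  rw [← cramer_transpose_apply, cramer_eq_adjugate_mulVec, ← adjugate_transpose]
  simp [mulVec, dotProduct, mul_comm]

theorem det_updateCol_eq_sum_adjugate {ι R : Type*} [Fintype ι] [DecidableEq ι] [CommRing R]
    (A : Matrix ι ι R) (j : ι) (b : ι → R) :
    (A.updateCol j b).det = ∑ i, b i * A.adjugate j i := by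
  rw [← cramer_apply, cramer_eq_adjugate_mulVec]
  simp [mulVec, dotProduct, mul_comm]

theorem sum_mul_adjugate_row {ι R : Type*} [Fintype ι] [DecidableEq ι] [CommRing R]
    (A : Matrix ι ι R) (i : ι) : ∑ j, A i j * A.adjugate j i = A.det :=
  (det_eq_sum_mul_adjugate_row A i).symm

theorem sum_mul_adjugate_col {ι R : Type*} [Fintype ι] [DecidableEq ι] [CommRing R]
    (A : Matrix ι ι R) (j : ι) : ∑ i, A i j * A.adjugate j i = A.det :=
  (det_eq_sum_mul_adjugate_col A j).symm

/-- The expansion of a bordered determinant with corner entry `1`: the Schur complement formula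
`det (D - u v) = det D - v (adj D) u`, without any invertibility. -/
theorem det_of_corner_eq_one {R : Type*} [CommRing R] {d : ℕ}
    (M : Matrix (Fin (d + 1)) (Fin (d + 1)) R) (h : M 0 0 = 1) :
    M.det = (M.submatrix Fin.succ Fin.succ).det -
      ∑ i, ∑ j, M i.succ 0 * M 0 j.succ * (M.submatrix Fin.succ Fin.succ).adjugate j i := by
  rw [det_succ_row_zero, Fin.sum_univ_succ, h, sum_comm, sub_eq_add_neg, ← sum_neg_distrib]
  congr 1
  · simp [Fin.succAbove_zero]
  refine sum_congr rfl fun j _ => ?_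
  have e : (M.submatrix Fin.succ (j.succ).succAbove).submatrix id j.cycleRange =
      (M.submatrix Fin.succ Fin.succ).updateCol j (fun i => M i.succ 0) := by
    ext a b
    simp only [submatrix_apply, id, updateCol_apply]
    rcases lt_trichotomy b j with hb | rfl | hb
    · have hne : b ≠ j := hb.ne
      rw [if_neg hne]
      have : (j.succ).succAbove (j.cycleRange b) = b.succ := by
        rw [Fin.succAbove_of_castSucc_lt]
        · ext; simp [Fin.coe_cycleRange_of_lt hb]
        · rw [Fin.lt_def]; simp [Fin.coe_cycleRange_of_lt hb]; exact hb
      rw [this]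
    · rcases d with _ | d
      · exact b.elim0
      · simp [Fin.cycleRange_self]
    · rw [if_neg hb.ne', Fin.cycleRange_of_gt hb, Fin.succAbove_of_le_castSucc]
      rw [Fin.le_def]; simpa using hb
  have e2 := congrArg det e
  rw [det_permute', det_updateCol_eq_sum_adjugate, Fin.sign_cycleRange] at e2
  have e3 : (M.submatrix Fin.succ (j.succ).succAbove).det =
      (-1) ^ (j : ℕ) * ∑ i, M i.succ 0 * (M.submatrix Fin.succ Fin.succ).adjugate j i := by
    rw [← e2]; push_cast
    rw [← mul_assoc, ← mul_pow]; simp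
  rw [e3, Fin.val_succ, pow_succ]
  have : ((-1 : R) ^ (j : ℕ)) * (-1) ^ (j : ℕ) = 1 := by rw [← mul_pow]; simp
  calc _ = -(((-1 : R) ^ (j : ℕ)) * (-1) ^ (j : ℕ)) * M 0 j.succ *
        ∑ i, M i.succ 0 * (M.submatrix Fin.succ Fin.succ).adjugate j i := by ring
    _ = _ := by
        rw [this, mul_sum, ← sum_neg_distrib]
        exact sum_congr rfl fun i _ => by ring

/-! ### The hook kernel and its box-adding and box-removing rules -/

/-- The kernel `g(p, q) = 1 / ((p + q + 1) p! q!)`. At Frobenius coordinates of a hook with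
`n` boxes it is the number of standard tableaux divided by `n!`. -/
def hookKernel (p q : ℕ) : ℝ := 1 / (((p : ℝ) + q + 1) * (p ! * q !))

/-- The matrix `[g(p_i, q_j)]`. A pair of tuples `(p, q)` is encoded as one function `r` on `ι ⊕ ι`,
so that adding a box is an update of `r` at one point. -/
def hookMatrix {ι : Type*} (r : ι ⊕ ι → ℕ) : Matrix ι ι ℝ :=
  Matrix.of fun i j => hookKernel (r (.inl i)) (r (.inr j))

/-- The determinant `G(p, q) = det [g(p_i, q_j)]`; at the Frobenius coordinates of a Young diagram
with `n` boxes it is the number of standard tableaux divided by `n!`. -/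
def hookDet {ι : Type*} [Fintype ι] [DecidableEq ι] (r : ι ⊕ ι → ℕ) : ℝ := (hookMatrix r).det

/-- With the convention `1 / (-1)! = 0` the left side is `g(p - 1, q) + g(p, q - 1)`. -/
theorem hookKernel_down (p q : ℕ) :
    (if p = 0 then 0 else hookKernel (p - 1) q) + (if q = 0 then 0 else hookKernel p (q - 1)) =
      ((p : ℝ) + q + 1) * hookKernel p q - if p = 0 ∧ q = 0 then 1 else 0 := by
  have h1 : ∀ n : ℕ, (n ! : ℝ) ≠ 0 := fun n => by positivity
  have h2 : ∀ n : ℕ, (n : ℝ) + 1 ≠ 0 := fun n => by positivity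
  rcases p with _ | p <;> rcases q with _ | q
  · simp [hookKernel]
  · have := h1 q; have := h2 q
    have h3 : (q : ℝ) + 1 + 1 ≠ 0 := by positivity
    simp [hookKernel, Nat.factorial_succ]; field_simp
  · have := h1 p; have := h2 p
    have h3 : (p : ℝ) + 1 + 1 ≠ 0 := by positivity
    simp [hookKernel, Nat.factorial_succ]; field_simp
  · have := h1 p; have := h2 p; have := h1 q; have := h2 q
    have h3 : (p : ℝ) + 1 + (q + 1) + 1 ≠ 0 := by positivity
    have h4 : (p : ℝ) + (q + 1) + 1 ≠ 0 := by positivity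
    have h5 : (p : ℝ) + 1 + q + 1 ≠ 0 := by positivity
    simp [hookKernel, Nat.factorial_succ]; field_simp; ring

/-- The numerator over `(p + q + 2) (p + 1)! (q + 1)!` is
`Q (P² + s P + t) + P (Q² - s Q + t) = (P + Q) (P Q + t)` for `P = p + 1`, `Q = q + 1`: the
terms with `s` cancel, and so does the factor `P + Q = p + q + 2`. -/
theorem hookKernel_up (s t : ℝ) (p q : ℕ) :
    (((p : ℝ) + 1) ^ 2 + s * (p + 1) + t) * hookKernel (p + 1) q +
      (((q : ℝ) + 1) ^ 2 - s * (q + 1) + t) * hookKernel p (q + 1) =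
      ((p : ℝ) + q + 1) * hookKernel p q + t * (hookKernel p 0 * hookKernel 0 q) := by
  have h1 : ∀ n : ℕ, (n ! : ℝ) ≠ 0 := fun n => by positivity
  have h2 : ∀ n : ℕ, (n : ℝ) + 1 ≠ 0 := fun n => by positivity
  have := h1 p; have := h2 p; have := h1 q; have := h2 q
  have h3 : (p : ℝ) + q + 1 ≠ 0 := by positivity
  have h4 : (p : ℝ) + (q + 1) + 1 ≠ 0 := by positivity
  have h5 : (p : ℝ) + 1 + q + 1 ≠ 0 := by positivity
  have h6 : (p : ℝ) + q + 2 ≠ 0 := by positivity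
  simp only [hookKernel, Nat.factorial_succ, Nat.cast_add, Nat.cast_one, Nat.cast_mul,
    Nat.cast_zero, Nat.factorial_zero, zero_add, add_zero, mul_one, one_mul]
  rw [show (p : ℝ) + 1 + q + 1 = p + q + 2 by ring, show (p : ℝ) + (q + 1) + 1 = p + q + 2 by ring]
  field_simp
  ring

section
variable {ι : Type*} [Fintype ι] [DecidableEq ι] (r : ι ⊕ ι → ℕ)

theorem hookDet_update_inl (i : ι) (k : ℕ) :
    hookDet (Function.update r (.inl i) k) =
      ∑ j, hookKernel k (r (.inr j)) * (hookMatrix r).adjugate j i := by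
  rw [← det_updateRow_eq_sum_adjugate, hookDet]
  congr 1
  ext a b
  simp only [hookMatrix, of_apply, updateRow_apply, Function.update_apply, Sum.inl.injEq]
  by_cases h : a = i <;> simp [h]

theorem hookDet_update_inr (j : ι) (k : ℕ) :
    hookDet (Function.update r (.inr j) k) =
      ∑ i, hookKernel (r (.inl i)) k * (hookMatrix r).adjugate j i := by
  rw [← det_updateCol_eq_sum_adjugate, hookDet]
  congr 1
  ext a b
  simp only [hookMatrix, of_apply, updateCol_apply, Function.update_apply, Sum.inr.injEq]
  by_cases h : b = j <;> simp [h]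

/-- Euler's relation: each row and each column contributes one copy of the determinant. -/
theorem sum_hook_mul_adjugate :
    ∑ i, ∑ j, ((r (.inl i) : ℝ) + r (.inr j) + 1) * hookKernel (r (.inl i)) (r (.inr j)) *
      (hookMatrix r).adjugate j i = (Fintype.card ι + ∑ x, (r x : ℝ)) * hookDet r := by
  have h1 := fun i => sum_mul_adjugate_row (hookMatrix r) i
  have h2 := fun j => sum_mul_adjugate_col (hookMatrix r) j
  change ∀ i, ∑ j, hookKernel (r (.inl i)) (r (.inr j)) * (hookMatrix r).adjugate j i
    = hookDet r at h1
  change ∀ j, ∑ i, hookKernel (r (.inl i)) (r (.inr j)) * (hookMatrix r).adjugate j i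
    = hookDet r at h2
  have e : ∀ i j, ((r (.inl i) : ℝ) + r (.inr j) + 1) * hookKernel (r (.inl i)) (r (.inr j)) *
      (hookMatrix r).adjugate j i =
      ((r (.inl i) : ℝ) + 1) * (hookKernel (r (.inl i)) (r (.inr j)) *
        (hookMatrix r).adjugate j i) +
      (r (.inr j) : ℝ) * (hookKernel (r (.inl i)) (r (.inr j)) *
        (hookMatrix r).adjugate j i) := fun i j => by ring
  simp_rw [e, sum_add_distrib]
  rw [sum_comm (f := fun i j => (r (.inr j) : ℝ) * _)]
  simp_rw [← mul_sum, h1, h2, ← sum_mul, Fintype.sum_sum_type, sum_add_distrib]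
  simp
  ring

/-- Removing a box, from an arm or a leg or as a whole hook `(0 | 0)`. For the Frobenius coordinates
of a diagram this is `dim λ = ∑ dim μ` over the diagrams `μ` obtained by removing one box. -/
theorem hookDet_down :
    ∑ x, (if r x = 0 then 0 else hookDet (Function.update r x (r x - 1))) +
      ∑ i, ∑ j, (if r (.inl i) = 0 ∧ r (.inr j) = 0 then (hookMatrix r).adjugate j i else 0) =
    (Fintype.card ι + ∑ x, (r x : ℝ)) * hookDet r := by
  rw [← sum_hook_mul_adjugate, Fintype.sum_sum_type]
  simp_rw [hookDet_update_inl, hookDet_update_inr]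
  have e1 : ∀ i, (if r (.inl i) = 0 then 0 else
      ∑ j, hookKernel (r (.inl i) - 1) (r (.inr j)) * (hookMatrix r).adjugate j i) =
      ∑ j, (if r (.inl i) = 0 then 0 else hookKernel (r (.inl i) - 1) (r (.inr j))) *
        (hookMatrix r).adjugate j i := fun i => by split_ifs <;> simp
  have e2 : ∀ j, (if r (.inr j) = 0 then 0 else
      ∑ i, hookKernel (r (.inl i)) (r (.inr j) - 1) * (hookMatrix r).adjugate j i) =
      ∑ i, (if r (.inr j) = 0 then 0 else hookKernel (r (.inl i)) (r (.inr j) - 1)) *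
        (hookMatrix r).adjugate j i := fun i => by split_ifs <;> simp
  simp_rw [e1, e2]
  have e3 : ∑ j, ∑ i, (if r (.inr j) = 0 then 0 else hookKernel (r (.inl i)) (r (.inr j) - 1)) *
      (hookMatrix r).adjugate j i =
      ∑ i, ∑ j, (if r (.inr j) = 0 then 0 else hookKernel (r (.inl i)) (r (.inr j) - 1)) *
      (hookMatrix r).adjugate j i := sum_comm
  rw [e3]
  rw [← sum_add_distrib, ← sum_add_distrib]
  refine sum_congr rfl fun i _ => ?_
  rw [← sum_add_distrib, ← sum_add_distrib]
  refine sum_congr rfl fun j _ => ?_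
  rw [← add_mul, hookKernel_down]
  split_ifs <;> ring

end

/-- The pair of tuples obtained by inserting a hook with zero arm and leg, that is a new diagonal
box, at the positions `i` and `j`. -/
def addHook {d : ℕ} (i j : Fin (d + 1)) (r : Fin d ⊕ Fin d → ℕ) : Fin (d + 1) ⊕ Fin (d + 1) → ℕ :=
  Sum.elim (i.insertNth 0 (r ∘ .inl)) (j.insertNth 0 (r ∘ .inr))

theorem hookDet_addHook_zero {d : ℕ} (r : Fin d ⊕ Fin d → ℕ) :
    hookDet (addHook 0 0 r) = hookDet r - ∑ i, ∑ j,
      hookKernel (r (.inl i)) 0 * hookKernel 0 (r (.inr j)) * (hookMatrix r).adjugate j i := by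
  have e : (hookMatrix (addHook 0 0 r)).submatrix Fin.succ Fin.succ = hookMatrix r := by
    ext a b; simp [hookMatrix, addHook]
  rw [hookDet, det_of_corner_eq_one _ (by simp [hookMatrix, addHook, hookKernel]), e]
  simp [hookMatrix, addHook, hookDet]

/-- Adding a box. For the Frobenius coordinates of a diagram `μ` with `n` boxes, `t = z w` and
`s = z + w`, it says that `∑ (z + c) (w + c) dim λ / (n + 1) = (z w + n) dim μ`, summed over the
diagrams `λ` obtained by adding a box, of content `c`. -/
theorem hookDet_up {d : ℕ} (s t : ℝ) (r : Fin d ⊕ Fin d → ℕ) :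
    ∑ i, (((r (.inl i) : ℝ) + 1) ^ 2 + s * (r (.inl i) + 1) + t) *
        hookDet (Function.update r (.inl i) (r (.inl i) + 1)) +
      ∑ j, (((r (.inr j) : ℝ) + 1) ^ 2 - s * (r (.inr j) + 1) + t) *
        hookDet (Function.update r (.inr j) (r (.inr j) + 1)) +
      t * hookDet (addHook 0 0 r) = (t + (d + ∑ x, (r x : ℝ))) * hookDet r := by
  have := sum_hook_mul_adjugate r
  rw [Fintype.card_fin] at this
  rw [add_mul t, ← this, hookDet_addHook_zero]
  simp_rw [hookDet_update_inl, hookDet_update_inr, mul_sum]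
  rw [sum_comm (s := univ) (t := univ) (f := fun j i => (((r (.inr j) : ℝ) + 1) ^ 2 - _ + _) * _)]
  rw [mul_sub, add_sub, sub_eq_iff_eq_add, add_comm _ (t * hookDet r), add_assoc]
  congr 1
  simp_rw [mul_sum, ← sum_add_distrib]
  refine sum_congr rfl fun i _ => sum_congr rfl fun j _ => ?_
  have := hookKernel_up s t (r (.inl i)) (r (.inr j))
  linear_combination (hookMatrix r).adjugate j i * this

theorem addHook_eq {d : ℕ} (i j : Fin (d + 1)) (r : Fin d ⊕ Fin d → ℕ) :
    addHook i j r = addHook 0 0 r ∘ Sum.map i.cycleRange j.cycleRange := by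
  funext x
  rcases x with x | x
  · simp [addHook, Fin.cons_apply_cycleRange]
  · simp [addHook, Fin.cons_apply_cycleRange]

theorem hookDet_comp_perm {ι : Type*} [Fintype ι] [DecidableEq ι] (r : ι ⊕ ι → ℕ)
    (σ τ : Equiv.Perm ι) :
    hookDet (r ∘ Sum.map σ τ) = (Equiv.Perm.sign σ * Equiv.Perm.sign τ : ℤ) * hookDet r := by
  have : hookMatrix (r ∘ Sum.map σ τ) = ((hookMatrix r).submatrix σ id).submatrix id τ := by
    ext a b; simp [hookMatrix]
  rw [hookDet, this, det_permute', det_permute, hookDet]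
  push_cast; ring

/-- The signs of the permutations that move the new row and column to the front cancel those of
the cofactor. -/
theorem hookDet_addHook_mul_adjugate {d : ℕ} (i j : Fin (d + 1)) (r : Fin d ⊕ Fin d → ℕ) :
    hookDet (addHook i j r) * (hookMatrix (addHook i j r)).adjugate j i =
      hookDet (addHook 0 0 r) * hookDet r := by
  rw [adjugate_fin_succ_eq_det_submatrix]
  have e : (hookMatrix (addHook i j r)).submatrix i.succAbove j.succAbove = hookMatrix r := by
    ext a b; simp [hookMatrix, addHook]
  rw [e, addHook_eq, hookDet_comp_perm, Fin.sign_cycleRange, Fin.sign_cycleRange, ← hookDet]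
  have : (((-1 : ℝ) ^ (i : ℕ)) * (-1) ^ (j : ℕ)) * (-1) ^ ((i : ℕ) + j) = 1 := by
    rw [← pow_add, ← mul_pow]; simp
  push_cast
  linear_combination (hookDet (addHook 0 0 r) * hookDet r) * this

theorem hookDet_of_not_injective {ι : Type*} [Fintype ι] [DecidableEq ι] (r : ι ⊕ ι → ℕ)
    (h : ¬ (Function.Injective (r ∘ Sum.inl) ∧ Function.Injective (r ∘ Sum.inr))) :
    hookDet r = 0 := by
  simp only [not_and_or, Function.Injective, not_forall] at h
  rcases h with ⟨a, b, h, hne⟩ | ⟨a, b, h, hne⟩ <;> simp only [Function.comp] at h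
  · exact det_zero_of_row_eq hne (by ext c; simp [hookMatrix, h])
  · exact det_zero_of_column_eq hne (fun c => by simp [hookMatrix, h])

/-! ### The sum of the weights of the diagrams with a given number of boxes -/

/-- Summation over the pairs of tuples of consecutive levels that differ in one coordinate, from
above and from below. -/
theorem sum_piAntidiag_update_pred {κ M : Type*} [Fintype κ] [DecidableEq κ] [AddCommMonoid M]
    (m : ℕ) (h : (κ → ℕ) → (κ → ℕ) → M) :
    ∑ r ∈ piAntidiag (univ : Finset κ) (m + 1), ∑ x,
        (if r x = 0 then 0 else h r (Function.update r x (r x - 1))) =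
      ∑ r ∈ piAntidiag (univ : Finset κ) m, ∑ x, h (Function.update r x (r x + 1)) r := by
  rw [sum_comm, sum_comm (s := piAntidiag _ m)]
  refine sum_congr rfl fun x _ => ?_
  have e : ∀ (r : κ → ℕ), (if r x = 0 then 0 else h r (Function.update r x (r x - 1))) =
      if r x ≠ 0 then h r (Function.update r x (r x - 1)) else 0 := fun r => by simp
  simp_rw [e]
  rw [← sum_filter]
  refine sum_bij' (fun r _ => Function.update r x (r x - 1))
    (fun r _ => Function.update r x (r x + 1)) ?_ ?_ ?_ ?_ ?_
  · intro r hr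
    simp only [mem_filter, mem_piAntidiag, mem_univ, implies_true, and_true] at hr ⊢
    have h1 := hr.1
    rw [← add_sum_erase _ _ (mem_univ x)] at h1 ⊢
    rw [sum_congr rfl fun y hy => Function.update_of_ne (ne_of_mem_erase hy) _ _]
    simp
    omega
  · intro r hr
    simp only [mem_filter, mem_piAntidiag, mem_univ, implies_true, and_true] at hr ⊢
    rw [← add_sum_erase _ _ (mem_univ x)] at hr ⊢
    rw [sum_congr rfl fun y hy => Function.update_of_ne (ne_of_mem_erase hy) _ _]
    simp
    omega
  · intro r hr
    simp only [mem_filter] at hr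
    simp [Nat.sub_add_cancel (Nat.pos_of_ne_zero hr.2)]
  · intro r hr
    simp
  · intro r hr
    simp only [mem_filter] at hr
    simp [Nat.sub_add_cancel (Nat.pos_of_ne_zero hr.2)]

theorem sum_addHook {d : ℕ} (i j : Fin (d + 1)) (r : Fin d ⊕ Fin d → ℕ) :
    ∑ x, addHook i j r x = ∑ x, r x := by
  rw [Fintype.sum_sum_type, Fintype.sum_sum_type,
    Fin.sum_univ_succAbove (fun x => addHook i j r (.inl x)) i,
    Fin.sum_univ_succAbove (fun x => addHook i j r (.inr x)) j]
  simp [addHook]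

theorem sum_piAntidiag_addHook {M : Type*} [AddCommMonoid M] (d m : ℕ) (i j : Fin (d + 1))
    (f : (Fin (d + 1) ⊕ Fin (d + 1) → ℕ) → M) :
    ∑ r ∈ piAntidiag (univ : Finset (Fin (d + 1) ⊕ Fin (d + 1))) m,
        (if r (.inl i) = 0 ∧ r (.inr j) = 0 then f r else 0) =
      ∑ r ∈ piAntidiag (univ : Finset (Fin d ⊕ Fin d)) m, f (addHook i j r) := by
  rw [← sum_filter]
  symm
  refine sum_bij' (fun r _ => addHook i j r)
    (fun r _ => r ∘ Sum.map i.succAbove j.succAbove) ?_ ?_ ?_ ?_ ?_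
  · intro r hr
    simp only [mem_filter, mem_piAntidiag, mem_univ, implies_true, and_true] at hr ⊢
    change ∑ x, addHook i j r x = m ∧ _
    rw [sum_addHook]
    exact ⟨hr, by simp [addHook]⟩
  · intro r hr
    simp only [mem_filter, mem_piAntidiag, mem_univ, implies_true, and_true] at hr ⊢
    rw [← hr.1]
    rw [Fintype.sum_sum_type, Fintype.sum_sum_type,
      Fin.sum_univ_succAbove (fun x => r (.inl x)) i,
      Fin.sum_univ_succAbove (fun x => r (.inr x)) j]
    simp [hr.2]
  · intro r hr
    funext x; rcases x with x | x <;> simp [addHook]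
  · intro r hr
    simp only [mem_filter] at hr
    funext x
    rcases x with x | x
    · refine Fin.succAboveCases i ?_ ?_ x
      · simp [addHook, hr.2]
      · simp [addHook]
    · refine Fin.succAboveCases j ?_ ?_ x
      · simp [addHook, hr.2]
      · simp [addHook]
  · intro r hr; rfl

/-- The product of `c² + s c + t` over the contents `c = 1, …, k`; for `s = z + w` and `t = z w`
it is `(z + 1)_k (w + 1)_k`. -/
def contentProd (s t : ℝ) (k : ℕ) : ℝ := ∏ i ∈ range k, (((i : ℝ) + 1) ^ 2 + s * (i + 1) + t)

/-- The product of `(z + c) (w + c)` over the contents of the boxes of a diagram with Frobenius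
coordinates `r`, where `s = z + w`, `t = z w`, divided by the number `(d!)²` of orderings of these
coordinates. -/
def tupleContent (s t : ℝ) {d : ℕ} (r : Fin d ⊕ Fin d → ℕ) : ℝ :=
  t ^ d / (d ! : ℝ) ^ 2 *
    ((∏ i, contentProd s t (r (.inl i))) * ∏ j, contentProd (-s) t (r (.inr j)))

theorem prod_update_add_one {κ M : Type*} [Fintype κ] [DecidableEq κ] [CommMonoid M]
    (f : ℕ → M) (r : κ → ℕ) (x : κ) (c : M) (h : f (r x + 1) = c * f (r x)) :
    ∏ y, f (Function.update r x (r x + 1) y) = c * ∏ y, f (r y) := by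
  rw [← mul_prod_erase _ _ (mem_univ x), ← mul_prod_erase _ (fun y => f (r y)) (mem_univ x)]
  rw [prod_congr rfl fun y hy => by rw [Function.update_of_ne (ne_of_mem_erase hy)]]
  simp [h, mul_assoc]

theorem contentProd_succ (s t : ℝ) (k : ℕ) :
    contentProd s t (k + 1) = (((k : ℝ) + 1) ^ 2 + s * (k + 1) + t) * contentProd s t k := by
  rw [contentProd, prod_range_succ, mul_comm]; rfl

theorem tupleContent_update_inl (s t : ℝ) {d : ℕ} (r : Fin d ⊕ Fin d → ℕ) (i : Fin d) :
    tupleContent s t (Function.update r (.inl i) (r (.inl i) + 1)) =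
      (((r (.inl i) : ℝ) + 1) ^ 2 + s * (r (.inl i) + 1) + t) * tupleContent s t r := by
  have := prod_update_add_one (contentProd s t) (r ∘ Sum.inl) i _ (contentProd_succ s t _)
  have e : ∀ y, Function.update r (Sum.inl i) (r (.inl i) + 1) (.inl y) =
      Function.update (r ∘ Sum.inl) i ((r ∘ Sum.inl) i + 1) y := fun y => by
    simp [Function.update_apply]
  simp only [tupleContent, e, this, ne_eq, reduceCtorEq, not_false_eq_true, Function.update_of_ne]
  simp only [Function.comp_apply]
  ring

theorem tupleContent_update_inr (s t : ℝ) {d : ℕ} (r : Fin d ⊕ Fin d → ℕ) (j : Fin d) :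
    tupleContent s t (Function.update r (.inr j) (r (.inr j) + 1)) =
      (((r (.inr j) : ℝ) + 1) ^ 2 - s * (r (.inr j) + 1) + t) * tupleContent s t r := by
  have := prod_update_add_one (contentProd (-s) t) (r ∘ Sum.inr) j _ (contentProd_succ (-s) t _)
  have e : ∀ y, Function.update r (Sum.inr j) (r (.inr j) + 1) (.inr y) =
      Function.update (r ∘ Sum.inr) j ((r ∘ Sum.inr) j + 1) y := fun y => by
    simp [Function.update_apply]
  simp only [tupleContent, e, this, ne_eq, reduceCtorEq, not_false_eq_true, Function.update_of_ne]
  simp only [Function.comp_apply]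
  ring

/-- The new box has content `0` and contributes `t`; the other factor adjusts `(d!)²`. -/
theorem tupleContent_addHook (s t : ℝ) {d : ℕ} (i j : Fin (d + 1)) (r : Fin d ⊕ Fin d → ℕ) :
    ((d : ℝ) + 1) ^ 2 * tupleContent s t (addHook i j r) = t * tupleContent s t r := by
  have h1 : (d ! : ℝ) ≠ 0 := by positivity
  have h2 : (d : ℝ) + 1 ≠ 0 := by positivity
  have h0 : ∀ s, contentProd s t 0 = 1 := fun s => by simp [contentProd]
  rw [tupleContent, Fin.prod_univ_succAbove _ i,
    Fin.prod_univ_succAbove (fun x => contentProd (-s) t (addHook i j r (.inr x))) j]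
  simp only [tupleContent, addHook, Sum.elim_inl, Sum.elim_inr, Fin.insertNth_apply_same,
    Fin.insertNth_apply_succAbove, h0,
    Function.comp, Nat.factorial_succ]
  push_cast
  field_simp
  ring

/-- The sum of the weights of the pairs of `d`-tuples with coordinate sum `m`, i.e. with
`d + m` boxes. -/
def levelSum (s t : ℝ) (d m : ℕ) : ℝ :=
  ∑ r ∈ piAntidiag (univ : Finset (Fin d ⊕ Fin d)) m, tupleContent s t r * hookDet r ^ 2

/-- The sum over the pairs of an element of the level `(d, m)` and a neighbour with one box less on
an arm or a leg, which belongs to the level `(d, m - 1)`. -/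
def levelSumRemoveBox (s t : ℝ) (d m : ℕ) : ℝ :=
  ∑ r ∈ piAntidiag (univ : Finset (Fin d ⊕ Fin d)) m, ∑ x, if r x = 0 then 0 else
    tupleContent s t r * hookDet r * hookDet (Function.update r x (r x - 1))

/-- The sum over the pairs of an element of the level `(d, m)` and a neighbour with one hook less,
which belongs to the level `(d - 1, m)`. -/
def levelSumRemoveHook (s t : ℝ) (d m : ℕ) : ℝ :=
  ∑ r ∈ piAntidiag (univ : Finset (Fin d ⊕ Fin d)) m, ∑ i, ∑ j,
    if r (.inl i) = 0 ∧ r (.inr j) = 0 then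
      tupleContent s t r * (hookDet r * (hookMatrix r).adjugate j i) else 0

theorem cast_sum_of_mem_piAntidiag {κ : Type*} [Fintype κ] [DecidableEq κ] {m : ℕ} {r : κ → ℕ}
    (hr : r ∈ piAntidiag univ m) : ∑ x, (r x : ℝ) = m := by
  simp only [mem_piAntidiag] at hr
  exact_mod_cast hr.1

theorem levelSum_down (s t : ℝ) (d m : ℕ) :
    ((d : ℝ) + m) * levelSum s t d m = levelSumRemoveBox s t d m + levelSumRemoveHook s t d m := by
  rw [levelSum, levelSumRemoveBox, levelSumRemoveHook, mul_sum, ← sum_add_distrib]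
  refine sum_congr rfl fun r hr => ?_
  have := hookDet_down r
  rw [cast_sum_of_mem_piAntidiag hr, Fintype.card_fin] at this
  have e : ((d : ℝ) + m) * (tupleContent s t r * hookDet r ^ 2) =
    tupleContent s t r * hookDet r * (((d : ℝ) + m) * hookDet r) := by ring
  rw [e, ← this, mul_add, mul_sum, mul_sum]
  simp_rw [mul_sum, mul_ite, mul_zero, mul_assoc]

theorem levelSumRemoveBox_succ (s t : ℝ) (d m : ℕ) :
    levelSumRemoveBox s t d (m + 1) = ∑ r ∈ piAntidiag (univ : Finset (Fin d ⊕ Fin d)) m, ∑ x,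
      tupleContent s t (Function.update r x (r x + 1)) *
        hookDet (Function.update r x (r x + 1)) * hookDet r :=
  sum_piAntidiag_update_pred m fun r r' => tupleContent s t r * hookDet r * hookDet r'

theorem levelSumRemoveHook_succ (s t : ℝ) (d m : ℕ) :
    levelSumRemoveHook s t (d + 1) m = ∑ r ∈ piAntidiag (univ : Finset (Fin d ⊕ Fin d)) m,
      t * tupleContent s t r * (hookDet (addHook 0 0 r) * hookDet r) := by
  rw [levelSumRemoveHook, sum_comm]
  have : ∀ i ∈ (univ : Finset (Fin (d + 1))), ∑ r ∈ piAntidiag univ m, ∑ j,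
      (if r (.inl i) = 0 ∧ r (.inr j) = 0 then
        tupleContent s t r * (hookDet r * (hookMatrix r).adjugate j i) else 0) =
      ∑ j : Fin (d + 1), ∑ r ∈ piAntidiag (univ : Finset (Fin d ⊕ Fin d)) m,
        (((d : ℝ) + 1) ^ 2)⁻¹ *
          (t * tupleContent s t r * (hookDet (addHook 0 0 r) * hookDet r)) := by
    intro i _
    rw [sum_comm]
    refine sum_congr rfl fun j _ => ?_
    rw [sum_piAntidiag_addHook]
    refine sum_congr rfl fun r _ => ?_
    rw [hookDet_addHook_mul_adjugate, ← tupleContent_addHook s t i j]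
    field_simp
  rw [sum_congr rfl this, sum_const, sum_const, ← mul_sum]
  simp
  field_simp

theorem levelSum_up (s t : ℝ) (d m : ℕ) :
    levelSumRemoveBox s t d (m + 1) + levelSumRemoveHook s t (d + 1) m =
      (t + (d + m)) * levelSum s t d m := by
  rw [levelSumRemoveBox_succ, levelSumRemoveHook_succ, levelSum, mul_sum, ← sum_add_distrib]
  refine sum_congr rfl fun r hr => ?_
  have := hookDet_up s t r
  rw [cast_sum_of_mem_piAntidiag hr] at this
  rw [Fintype.sum_sum_type]
  simp_rw [tupleContent_update_inl, tupleContent_update_inr]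
  have e : (t + (d + m)) * (tupleContent s t r * hookDet r ^ 2) =
    tupleContent s t r * hookDet r * ((t + (d + m)) * hookDet r) := by ring
  rw [e, ← this, mul_add, mul_add, mul_sum, mul_sum]
  congr 1
  · congr 1 <;> exact sum_congr rfl fun i _ => by ring
  · ring

theorem levelSumRemoveBox_zero (s t : ℝ) (d : ℕ) : levelSumRemoveBox s t d 0 = 0 := by
  simp [levelSumRemoveBox]

theorem levelSumRemoveHook_zero (s t : ℝ) (m : ℕ) : levelSumRemoveHook s t 0 m = 0 := by
  simp [levelSumRemoveHook]

/-- The weights of the diagrams with `n` boxes sum to `(t)_n / n!`: the z-measure on these diagrams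
is a probability measure. -/
theorem sum_levelSum (s t : ℝ) (n : ℕ) :
    ∑ x ∈ antidiagonal n, levelSum s t x.1 x.2 = (ascPochhammer ℝ n).eval t / n ! := by
  induction n with
  | zero => simp [levelSum, tupleContent, hookDet]
  | succ n ih =>
    have h1 : ((n : ℝ) + 1) * ∑ x ∈ antidiagonal (n + 1), levelSum s t x.1 x.2 =
        (t + n) * ∑ x ∈ antidiagonal n, levelSum s t x.1 x.2 := by
      calc _ = ∑ x ∈ antidiagonal (n + 1),
            (levelSumRemoveBox s t x.1 x.2 + levelSumRemoveHook s t x.1 x.2) := by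
            rw [mul_sum]
            refine sum_congr rfl fun x hx => ?_
            rw [← levelSum_down]
            rw [HasAntidiagonal.mem_antidiagonal] at hx
            rw [← Nat.cast_add, hx]; push_cast; rfl
        _ = ∑ x ∈ antidiagonal n,
            (levelSumRemoveBox s t x.1 (x.2 + 1) + levelSumRemoveHook s t (x.1 + 1) x.2) := by
            rw [sum_add_distrib, sum_add_distrib, Nat.sum_antidiagonal_succ',
              Nat.sum_antidiagonal_succ (f := fun x => levelSumRemoveHook s t x.1 x.2)]
            simp [levelSumRemoveBox_zero, levelSumRemoveHook_zero]
        _ = _ := by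
            rw [mul_sum]
            refine sum_congr rfl fun x hx => ?_
            rw [levelSum_up]
            rw [HasAntidiagonal.mem_antidiagonal] at hx
            rw [← Nat.cast_add, hx]
    rw [ih] at h1
    have h2 : (n : ℝ) + 1 ≠ 0 := by positivity
    rw [ascPochhammer_succ_eval, Nat.factorial_succ, eq_div_iff (by positivity)]
    push_cast
    rw [← mul_assoc, mul_comm _ ((n : ℝ) + 1), h1]
    field_simp

theorem hasSum_ascPochhammer_div_factorial (t : ℝ) {ξ : ℝ} (h0 : 0 < ξ) (h1 : ξ < 1) :
    HasSum (fun n : ℕ => (ascPochhammer ℝ n).eval t / n ! * ξ ^ n) ((1 - ξ) ^ (-t)) := by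
  have h := (Real.one_div_one_sub_rpow_hasFPowerSeriesOnBall_zero t).hasSum (y := ξ) (by
    simp [Real.enorm_eq_ofReal h0.le, h1])
  rw [Real.rpow_neg (by linarith)]
  simp only [FormalMultilinearSeries.ofScalars_apply_eq, zero_add, one_div, smul_eq_mul] at h
  refine h.congr_fun ?_
  intro n
  have := Ring.factorial_nsmul_multichoose_eq_ascPochhammer t n
  rw [nsmul_eq_mul, Polynomial.ascPochhammer_smeval_eq_eval] at this
  rw [← Ring.multichoose_eq, ← this]
  field_simp

/-! ### From tuples to configurations on the half-integers -/

theorem hasSum_of_hasSum_sum_fiber {α : Type*} {f : α → ℝ} (hf : ∀ a, 0 ≤ f a) (deg : α → ℕ)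
    (s : ℕ → Finset α) (hs : ∀ n a, a ∈ s n ↔ deg a = n) {c : ℝ}
    (h : HasSum (fun n => ∑ a ∈ s n, f a) c) : HasSum f c := by
  have hfib : ∀ n, HasSum (fun a : {a // deg a = n} => f a) (∑ a ∈ s n, f a) := by
    intro n
    have hn : {a | deg a = n} = ↑(s n) := by ext a; simp [hs]
    change HasSum (fun a : {a | deg a = n} => f a) _
    rw [hn]
    exact (s n).hasSum f
  rw [← (Equiv.sigmaFiberEquiv deg).hasSum_iff]
  have hsum : Summable (f ∘ Equiv.sigmaFiberEquiv deg) := by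
    refine (summable_sigma_of_nonneg (fun x => hf _)).2
       ⟨fun n => (hfib n).summable, ?_⟩
    refine h.summable.congr fun n => ?_
    exact (hfib n).tsum_eq.symm
  have h2 := hsum.hasSum.sigma (fun n => hfib n)
  rw [h.unique h2]
  exact hsum.hasSum

/-- Pairs of `d`-tuples of natural numbers, for all `d`, encoded as in `hookMatrix`. -/
abbrev FrobTuple : Type := Σ d : ℕ, (Fin d ⊕ Fin d → ℕ)

/-- The weight of a pair of tuples, with its power of `ξ`. -/
def tupleMass (s t ξ : ℝ) (x : FrobTuple) : ℝ :=
  tupleContent s t x.2 * hookDet x.2 ^ 2 * ξ ^ (x.1 + ∑ a, x.2 a)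

theorem hasSum_tupleMass {s t ξ : ℝ} (ht : 0 ≤ t) (h1 : ∀ k, 0 ≤ contentProd s t k)
    (h2 : ∀ k, 0 ≤ contentProd (-s) t k) (h0 : 0 < ξ) (hξ : ξ < 1) :
    HasSum (tupleMass s t ξ) ((1 - ξ) ^ (-t)) := by
  refine hasSum_of_hasSum_sum_fiber (fun x => ?_) (fun x => x.1 + ∑ a : Fin x.1 ⊕ Fin x.1, x.2 a)
    (fun n => (range (n + 1)).sigma fun d => piAntidiag univ (n - d)) (fun n x => ?_) ?_
  · refine mul_nonneg (mul_nonneg (mul_nonneg (by positivity) (mul_nonneg ?_ ?_)) (sq_nonneg _))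
      (by positivity)
    · exact prod_nonneg fun i _ => h1 _
    · exact prod_nonneg fun i _ => h2 _
  · simp only [mem_sigma, mem_range, mem_piAntidiag, mem_univ, implies_true, and_true]
    change _ ∧ ∑ a, x.2 a = _ ↔ _
    omega
  · convert hasSum_ascPochhammer_div_factorial t h0 hξ using 2 with n
    rw [← sum_levelSum s, sum_sigma,
      Nat.sum_antidiagonal_eq_sum_range_succ (fun d m => levelSum s t d m), sum_mul]
    refine sum_congr rfl fun d hd => ?_
    rw [levelSum, sum_mul]
    refine sum_congr rfl fun r hr => ?_
    simp only [mem_piAntidiag] at hr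
    rw [tupleMass]
    congr 2
    change d + univ.sum r = n
    rw [hr.1]
    rw [mem_range] at hd; omega

/-- The configuration `{p_i + 1/2} ∪ {-q_j - 1/2}`. -/
def pairConf {d e : ℕ} (p : Fin d → ℕ) (q : Fin e → ℕ) : Finset HalfInt :=
  (univ.image fun i => posHalf (p i)) ∪ (univ.image fun i => negHalf (q i))

theorem posHalf_injective : Function.Injective posHalf := fun a b h =>
  Sum.inl.inj (halfIntEquiv.injective (show halfIntEquiv (.inl a) = halfIntEquiv (.inl b) from h))

theorem negHalf_injective : Function.Injective negHalf := fun a b h =>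
  Sum.inr.inj (halfIntEquiv.injective (show halfIntEquiv (.inr a) = halfIntEquiv (.inr b) from h))

theorem posHalf_ne_negHalf (a b : ℕ) : posHalf a ≠ negHalf b := fun h =>
  Sum.inl_ne_inr
    (halfIntEquiv.injective (show halfIntEquiv (.inl a) = halfIntEquiv (.inr b) from h))

@[simp]
theorem posHalf_mem_pairConf {d e : ℕ} {p : Fin d → ℕ} {q : Fin e → ℕ} {k : ℕ} :
    posHalf k ∈ pairConf p q ↔ k ∈ Set.range p := by
  simp [pairConf, posHalf_injective.eq_iff, (posHalf_ne_negHalf _ _).symm]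

@[simp]
theorem negHalf_mem_pairConf {d e : ℕ} {p : Fin d → ℕ} {q : Fin e → ℕ} {k : ℕ} :
    negHalf k ∈ pairConf p q ↔ k ∈ Set.range q := by
  simp [pairConf, negHalf_injective.eq_iff, posHalf_ne_negHalf]

theorem ext_halfInt {X Y : Finset HalfInt} (h1 : ∀ k, posHalf k ∈ X ↔ posHalf k ∈ Y)
    (h2 : ∀ k, negHalf k ∈ X ↔ negHalf k ∈ Y) : X = Y := by
  ext x
  obtain ⟨y, rfl⟩ := halfIntEquiv.surjective x
  rcases y with k | k
  · exact h1 k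
  · exact h2 k

theorem pairConf_eq_iff {d e d' e' : ℕ} {p : Fin d → ℕ} {q : Fin e → ℕ} {p' : Fin d' → ℕ}
    {q' : Fin e' → ℕ} :
    pairConf p q = pairConf p' q' ↔ Set.range p = Set.range p' ∧ Set.range q = Set.range q' := by
  constructor
  · intro h
    constructor
    · ext k; rw [← posHalf_mem_pairConf (q := q), h, posHalf_mem_pairConf]
    · ext k; rw [← negHalf_mem_pairConf (p := p), h, negHalf_mem_pairConf]
  · rintro ⟨h1, h2⟩
    exact ext_halfInt (fun k => by simp only [posHalf_mem_pairConf, h1])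
      (fun k => by simp only [negHalf_mem_pairConf, h2])

theorem exists_pairConf (X : Finset HalfInt) : ∃ (d e : ℕ) (p : Fin d → ℕ) (q : Fin e → ℕ),
    StrictAnti p ∧ StrictAnti q ∧ X = pairConf p q := by
  obtain ⟨P, hP⟩ : ∃ P : Finset ℕ, ∀ k, k ∈ P ↔ posHalf k ∈ X :=
    ⟨X.preimage posHalf posHalf_injective.injOn, by simp⟩
  obtain ⟨Q, hQ⟩ : ∃ Q : Finset ℕ, ∀ k, k ∈ Q ↔ negHalf k ∈ X :=
    ⟨X.preimage negHalf negHalf_injective.injOn, by simp⟩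
  refine ⟨P.card, Q.card, P.orderEmbOfFin rfl ∘ Fin.rev, Q.orderEmbOfFin rfl ∘ Fin.rev,
    (P.orderEmbOfFin rfl).strictMono.comp_strictAnti Fin.rev_strictAnti,
    (Q.orderEmbOfFin rfl).strictMono.comp_strictAnti Fin.rev_strictAnti, ?_⟩
  refine ext_halfInt (fun k => ?_) (fun k => ?_)
  · rw [posHalf_mem_pairConf, Fin.rev_surjective.range_comp, range_orderEmbOfFin, ← hP]; rfl
  · rw [negHalf_mem_pairConf, Fin.rev_surjective.range_comp, range_orderEmbOfFin, ← hQ]; rfl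

theorem exists_perm_of_range_eq {d e : ℕ} {p : Fin d → ℕ} {p' : Fin e → ℕ}
    (hp : Function.Injective p) (hp' : Function.Injective p') (h : Set.range p = Set.range p') :
    ∃ σ : Fin e ≃ Fin d, p' = p ∘ σ := by
  refine ⟨(Equiv.ofInjective p' hp').trans
    ((Equiv.setCongr h.symm).trans (Equiv.ofInjective p hp).symm), ?_⟩
  funext i
  simp only [Function.comp, Equiv.trans_apply, Equiv.apply_ofInjective_symm]
  simp

/-- The configuration of a pair of tuples. -/
def FrobTuple.conf (x : FrobTuple) : Finset HalfInt := pairConf (x.2 ∘ .inl) (x.2 ∘ .inr)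

/-- Both tuples consist of distinct numbers. -/
def FrobTuple.IsInj (x : FrobTuple) : Prop :=
  Function.Injective (x.2 ∘ Sum.inl) ∧ Function.Injective (x.2 ∘ Sum.inr)

/-- A configuration with `d` points of each sign comes from exactly `(d!)²` pairs of tuples with
distinct coordinates, so a sum over pairs of tuples becomes a sum over configurations. -/
theorem hasSum_of_hasSum_tuple {f : FrobTuple → ℝ} {g : Finset HalfInt → ℝ} {c : ℝ}
    (hf : HasSum f c) (hf0 : ∀ x : FrobTuple, ¬ x.IsInj → f x = 0)
    (hg : ∀ x : FrobTuple, x.IsInj → f x = g x.conf / (x.1 ! : ℝ) ^ 2)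
    (hg0 : ∀ X, (∀ x : FrobTuple, x.IsInj → x.conf ≠ X) → g X = 0) : HasSum g c := by
  rw [← (Equiv.sigmaFiberEquiv FrobTuple.conf).hasSum_iff] at hf
  refine hf.sigma fun X => ?_
  simp only [Function.comp, Equiv.sigmaFiberEquiv, Equiv.coe_fn_mk]
  by_cases hX : ∃ x : FrobTuple, x.IsInj ∧ x.conf = X
  swap
  · push Not at hX
    rw [hg0 X hX]
    convert hasSum_zero (α := ℝ) (β := {x : FrobTuple // x.conf = X}) using 2 with y
    exact hf0 _ fun h => hX _ h y.2
  obtain ⟨⟨d, r⟩, hinj, rfl⟩ := hX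
  have key : ∀ σ τ : Equiv.Perm (Fin d),
      FrobTuple.IsInj ⟨d, r ∘ Sum.map σ τ⟩ ∧
      FrobTuple.conf ⟨d, r ∘ Sum.map σ τ⟩ = FrobTuple.conf ⟨d, r⟩ := by
    intro σ τ
    refine ⟨⟨hinj.1.comp σ.injective, hinj.2.comp τ.injective⟩, ?_⟩
    refine pairConf_eq_iff.2 ⟨?_, ?_⟩
    · exact σ.surjective.range_comp (r ∘ Sum.inl)
    · exact τ.surjective.range_comp (r ∘ Sum.inr)
  let u : Equiv.Perm (Fin d) × Equiv.Perm (Fin d) →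
      {x : FrobTuple // x.conf = FrobTuple.conf ⟨d, r⟩} :=
    fun στ => ⟨⟨d, r ∘ Sum.map στ.1 στ.2⟩, (key στ.1 στ.2).2⟩
  have hu : Function.Injective u := by
    rintro ⟨σ, τ⟩ ⟨σ', τ'⟩ h
    have h' : r ∘ Sum.map σ τ = r ∘ Sum.map σ' τ' := by
      have := congrArg Subtype.val h
      simpa [u] using this
    refine Prod.ext (Equiv.ext fun i => hinj.1 ?_) (Equiv.ext fun i => hinj.2 ?_)
    · exact congrFun h' (.inl i)
    · exact congrFun h' (.inr i)
  rw [← hu.hasSum_iff]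
  · have e : (fun x : {x : FrobTuple // x.conf = FrobTuple.conf ⟨d, r⟩} => f x) ∘ u =
        fun _ => g (FrobTuple.conf ⟨d, r⟩) / (d ! : ℝ) ^ 2 := by
      funext στ
      simp only [Function.comp, u]
      rw [hg _ (key _ _).1, (key _ _).2]
    rw [e]
    convert hasSum_fintype (fun _ : Equiv.Perm (Fin d) × Equiv.Perm (Fin d) =>
      g (FrobTuple.conf ⟨d, r⟩) / (d ! : ℝ) ^ 2) using 1
    simp [Fintype.card_perm]
    field_simp
  · rintro ⟨⟨d', r'⟩, hx⟩ hn
    refine hf0 _ fun hinj' => hn ?_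
    have hr := pairConf_eq_iff.1 hx
    obtain ⟨σ, hσ⟩ := exists_perm_of_range_eq hinj.1 hinj'.1 hr.1.symm
    obtain rfl : d' = d := by simpa using Fintype.card_congr σ
    obtain ⟨τ, hτ⟩ := exists_perm_of_range_eq hinj.2 hinj'.2 hr.2.symm
    refine ⟨(σ, τ), Subtype.ext ?_⟩
    simp only [u, Sigma.mk.injEq, heq_eq_eq, true_and]
    funext y
    rcases y with i | i
    · exact (congrFun hσ i).symm
    · exact (congrFun hτ i).symm

/-! ### Determinants with vanishing diagonal blocks -/

theorem det_submatrix_pairConf {R : Type*} [CommRing R] (K : Matrix HalfInt HalfInt R) {d e : ℕ}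
    {p : Fin d → ℕ} {q : Fin e → ℕ} (hp : Function.Injective p) (hq : Function.Injective q) :
    (K.submatrix (Subtype.val : pairConf p q → HalfInt) Subtype.val).det =
      (K.submatrix (halfIntEquiv ∘ Sum.map p q) (halfIntEquiv ∘ Sum.map p q)).det := by
  have hmem : ∀ x : Fin d ⊕ Fin e, halfIntEquiv (Sum.map p q x) ∈ pairConf p q := by
    rintro (i | j)
    · exact posHalf_mem_pairConf.2 ⟨i, rfl⟩
    · exact negHalf_mem_pairConf.2 ⟨j, rfl⟩
  let f : Fin d ⊕ Fin e ≃ pairConf p q :=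
    Equiv.ofBijective (fun x => ⟨halfIntEquiv (Sum.map p q x), hmem x⟩) (by
      constructor
      · intro x y h
        exact (hp.sumMap hq) (halfIntEquiv.injective (congrArg Subtype.val h))
      · rintro ⟨x, hx⟩
        obtain ⟨y, rfl⟩ := halfIntEquiv.surjective x
        rcases y with k | k
        · obtain ⟨i, rfl⟩ := posHalf_mem_pairConf.1 hx
          exact ⟨.inl i, rfl⟩
        · obtain ⟨i, rfl⟩ := negHalf_mem_pairConf.1 hx
          exact ⟨.inr i, rfl⟩)
  rw [← det_submatrix_equiv_self f]
  rfl

theorem det_fromBlocks_zero_diag {R ι : Type*} [CommRing R] [Fintype ι] [DecidableEq ι]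
    (A B : Matrix ι ι R) : (fromBlocks 0 A (-B) 0).det = A.det * B.det := by
  -- `[[0, A], [-B, 0]] = [[A, 0], [0, B]] * [[0, 1], [-1, 0]]`, and the last factor is a product
  -- of three unipotent matrices, so it has determinant `1`.
  have h1 : fromBlocks 0 A (-B) 0 = fromBlocks A 0 0 B * (fromBlocks 1 1 0 1 *
      fromBlocks 1 0 (-1) 1 * fromBlocks 1 1 0 1 : Matrix (ι ⊕ ι) (ι ⊕ ι) R) := by
    simp [fromBlocks_multiply]
  rw [h1, det_mul, det_mul, det_mul, det_fromBlocks_zero₂₁, det_fromBlocks_zero₂₁,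
    det_fromBlocks_zero₁₂]
  simp

/-- A permutation with a nonzero contribution exchanges the two blocks, which forces them to have
the same size. -/
theorem det_fromBlocks_zero_diag_of_card_ne {R ι κ : Type*} [CommRing R] [Fintype ι] [DecidableEq ι]
    [Fintype κ] [DecidableEq κ] (h : Fintype.card ι ≠ Fintype.card κ)
    (A : Matrix ι κ R) (B : Matrix κ ι R) : (fromBlocks 0 A B 0).det = 0 := by
  rw [det_apply]
  refine sum_eq_zero fun σ _ => ?_
  rw [smul_eq_zero_iff_eq]
  by_contra hne
  have hx : ∀ x, fromBlocks 0 A B 0 (σ x) x ≠ 0 := fun x hx =>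
    hne (prod_eq_zero (mem_univ x) hx)
  have h1 : ∀ i, ∃ j, σ (.inl i) = .inr j := by
    intro i
    have := hx (.inl i)
    rcases hσ : σ (.inl i) with a | b
    · rw [hσ] at this; simp at this
    · exact ⟨b, rfl⟩
  have h2 : ∀ j, ∃ i, σ (.inr j) = .inl i := by
    intro i
    have := hx (.inr i)
    rcases hσ : σ (.inr i) with a | b
    · exact ⟨a, rfl⟩
    · rw [hσ] at this; simp at this
  choose f hf using h1
  choose g hg using h2
  refine h (le_antisymm (Fintype.card_le_of_injective f fun a b hab => ?_)
    (Fintype.card_le_of_injective g fun a b hab => ?_))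
  · exact Sum.inl_injective (σ.injective (by rw [hf, hf, hab]))
  · exact Sum.inr_injective (σ.injective (by rw [hg, hg, hab]))


/-! ### The principal minors of the matrix -/

theorem psiWpsi_neg (z w : ℂ) (ξ : ℝ) (k l : ℕ) :
    psiWpsi (-z) (-w) ξ k l = psiWpsi z w ξ l k := by
  simp only [psiWpsi, wMatrix, of_apply, neg_neg]
  rw [add_comm (k : ℝ) l]
  ring

theorem zLMatrix_submatrix (z w : ℂ) (ξ : ℝ) {d e : ℕ} (p : Fin d → ℕ) (q : Fin e → ℕ) :
    (zLMatrix z w ξ).submatrix (halfIntEquiv ∘ Sum.map p q) (halfIntEquiv ∘ Sum.map p q) =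
      fromBlocks 0 ((psiWpsi z w ξ).submatrix p q) (-((psiWpsi z w ξ).submatrix p q)ᵀ) 0 := by
  ext x y
  rcases x with i | i <;> rcases y with j | j <;> simp [zLMatrix, psiWpsi_neg]

theorem tParam_neg (z w : ℂ) : tParam (-z) (-w) = tParam z w := by simp [tParam]

theorem AdmissibleParams.coe_contentProd {z w : ℂ} (h : AdmissibleParams z w) (k : ℕ) :
    poch (z + 1) k * poch (w + 1) k = (contentProd (z + w).re (tParam z w) k : ℝ) := by
  induction k with
  | zero => simp [poch, contentProd]
  | succ k ih =>
    rw [contentProd_succ, Complex.ofReal_mul, ← ih]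
    push_cast
    rw [h.coe_tParam, show ((z + w).re : ℂ) = z + w from
      Complex.ext (by simp) (by rw [h.add_im, Complex.ofReal_im])]
    simp only [poch, ascPochhammer_succ_eval]
    ring

theorem AdmissibleParams.pochPair_eq {z w : ℂ} (h : AdmissibleParams z w) (k : ℕ) :
    pochPair z w k = contentProd (z + w).re (tParam z w) k := by
  rw [pochPair, h.coe_contentProd, Complex.ofReal_re]

theorem AdmissibleParams.pochPair_neg_eq {z w : ℂ} (h : AdmissibleParams z w) (k : ℕ) :
    pochPair (-z) (-w) k = contentProd (-(z + w).re) (tParam z w) k := by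
  rw [h.neg.pochPair_eq, tParam_neg]
  congr 1
  simp [add_comm]

theorem AdmissibleParams.psiWeight_pos {z w : ℂ} (h : AdmissibleParams z w) {ξ : ℝ} (h0 : 0 < ξ)
    (h1 : ξ < 1) (k : ℕ) : 0 < psiWeight z w ξ k := by
  have := h.pochPair_pos k
  have := h.tParam_pos
  have : 0 < 1 - ξ := by linarith
  unfold psiWeight
  positivity

theorem AdmissibleParams.psiWeight_mul {z w : ℂ} (h : AdmissibleParams z w) {ξ : ℝ} (h0 : 0 < ξ)
    (h1 : ξ < 1) (k l : ℕ) : psiWeight z w ξ k * psiWeight (-z) (-w) ξ l =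
      tParam z w * ξ ^ (k + l + 1) *
        (pochPair z w k * pochPair (-z) (-w) l / ((k ! : ℝ) ^ 2 * (l ! : ℝ) ^ 2)) := by
  have hξ : 0 < 1 - ξ := by linarith
  -- The factors `(1 - ξ) ^ (±(z + w))` cancel.
  have e1 : (1 - ξ) ^ (z + w).re * (1 - ξ) ^ (-z + -w).re = 1 := by
    rw [← Real.rpow_add hξ, ← neg_add, Complex.neg_re, add_neg_cancel, Real.rpow_zero]
  have e2 : ξ ^ ((k : ℝ) + 1 / 2) * ξ ^ ((l : ℝ) + 1 / 2) = ξ ^ (k + l + 1) := by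
    rw [← Real.rpow_add h0, ← Real.rpow_natCast]; congr 1; push_cast; ring
  have e3 := Real.mul_self_sqrt h.tParam_pos.le
  rw [psiWeight, psiWeight, tParam_neg, div_mul_div_comm]
  rw [← e2]
  nth_rw 3 [← e3]
  rw [mul_div_assoc', div_eq_div_iff (by positivity) (by positivity)]
  linear_combination (√(tParam z w) * √(tParam z w) * ξ ^ ((k : ℝ) + 1 / 2) *
    ξ ^ ((l : ℝ) + 1 / 2) * pochPair z w k * pochPair (-z) (-w) l * k ! ^ 2 * l ! ^ 2) * e1

/-- The principal minor of the matrix `L` indexed by `X`. -/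
def zLMinor (z w : ℂ) (ξ : ℝ) (X : Finset HalfInt) : ℝ :=
  ((zLMatrix z w ξ).submatrix (Subtype.val : X → HalfInt) Subtype.val).det

theorem zLMinor_pairConf_of_ne (z w : ℂ) (ξ : ℝ) {d e : ℕ} (hde : d ≠ e) {p : Fin d → ℕ}
    {q : Fin e → ℕ} (hp : Function.Injective p) (hq : Function.Injective q) :
    zLMinor z w ξ (pairConf p q) = 0 := by
  rw [zLMinor, det_submatrix_pairConf _ hp hq, zLMatrix_submatrix]
  exact det_fromBlocks_zero_diag_of_card_ne (by simpa using hde) _ _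

theorem AdmissibleParams.zLMinor_pairConf {z w : ℂ} (h : AdmissibleParams z w) {ξ : ℝ} (h0 : 0 < ξ)
    (h1 : ξ < 1) {d : ℕ} {p q : Fin d → ℕ}
    (hp : Function.Injective p) (hq : Function.Injective q) :
    zLMinor z w ξ (pairConf p q) =
      tParam z w ^ d * (∏ i, pochPair z w (p i) * pochPair (-z) (-w) (q i) /
        (((p i)! : ℝ) ^ 2 * ((q i)! : ℝ) ^ 2)) *
      (Matrix.of fun i j => (1 : ℝ) / ((p i : ℝ) + (q j : ℝ) + 1)).det ^ 2 *
      ξ ^ ∑ i, (p i + q i + 1) := by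
  rw [zLMinor, det_submatrix_pairConf _ hp hq, zLMatrix_submatrix, det_fromBlocks_zero_diag,
    det_transpose]
  have e : (psiWpsi z w ξ).submatrix p q = of fun i j => √(psiWeight (-z) (-w) ξ (q j)) *
      (of fun i j => √(psiWeight z w ξ (p i)) * (of fun i j : Fin d =>
        (1 : ℝ) / ((p i : ℝ) + (q j : ℝ) + 1)) i j) i j := by
    ext i j
    simp only [psiWpsi, wMatrix, of_apply, submatrix_apply]
    ring
  rw [e, det_mul_row, det_mul_column]
  set D := (Matrix.of fun i j => (1 : ℝ) / ((p i : ℝ) + (q j : ℝ) + 1)).det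
  have e1 : (∏ i, √(psiWeight z w ξ (p i))) * (∏ i, √(psiWeight z w ξ (p i))) =
      ∏ i, psiWeight z w ξ (p i) := by
    rw [← prod_mul_distrib]
    exact prod_congr rfl fun i _ => Real.mul_self_sqrt (h.psiWeight_pos h0 h1 _).le
  have e2 : (∏ i, √(psiWeight (-z) (-w) ξ (q i))) * (∏ i, √(psiWeight (-z) (-w) ξ (q i))) =
      ∏ i, psiWeight (-z) (-w) ξ (q i) := by
    rw [← prod_mul_distrib]
    exact prod_congr rfl fun i _ => Real.mul_self_sqrt (h.neg.psiWeight_pos h0 h1 _).le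
  have e3 : (∏ i, psiWeight z w ξ (p i)) * ∏ i, psiWeight (-z) (-w) ξ (q i) =
      tParam z w ^ d * ξ ^ (∑ i, (p i + q i + 1)) *
      (∏ i, pochPair z w (p i) * pochPair (-z) (-w) (q i) /
        (((p i)! : ℝ) ^ 2 * ((q i)! : ℝ) ^ 2)) := by
    rw [← prod_mul_distrib, prod_congr rfl fun i _ => h.psiWeight_mul h0 h1 (p i) (q i),
      prod_mul_distrib, prod_mul_distrib, prod_pow_eq_pow_sum, prod_const, card_univ,
      Fintype.card_fin]
  linear_combination D ^ 2 * ((∏ i, √(psiWeight z w ξ (p i))) ^ 2 * e2 +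
    (∏ i, psiWeight (-z) (-w) ξ (q i)) * e1 + e3)

theorem det_one_div_eq_mul_hookDet {d : ℕ} (r : Fin d ⊕ Fin d → ℕ) :
    (Matrix.of fun i j => (1 : ℝ) / ((r (.inl i) : ℝ) + (r (.inr j) : ℝ) + 1)).det =
      (∏ i, ((r (.inl i))! : ℝ)) * (∏ j, ((r (.inr j))! : ℝ)) * hookDet r := by
  have e : (Matrix.of fun i j => (1 : ℝ) / ((r (.inl i) : ℝ) + (r (.inr j) : ℝ) + 1)) =
      of fun i j => ((r (.inl i))! : ℝ) *
        (of fun i j => ((r (.inr j))! : ℝ) * hookMatrix r i j) i j := by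
    ext i j
    have : (r (.inl i) : ℝ) + (r (.inr j) : ℝ) + 1 ≠ 0 := by positivity
    have := Nat.cast_ne_zero (R := ℝ).2 (r (.inl i)).factorial_ne_zero
    have := Nat.cast_ne_zero (R := ℝ).2 (r (.inr j)).factorial_ne_zero
    simp only [hookMatrix, hookKernel, of_apply]
    field_simp
  rw [e, det_mul_column, det_mul_row, hookDet, mul_assoc]

theorem AdmissibleParams.tupleMass_eq {z w : ℂ} (h : AdmissibleParams z w) {ξ : ℝ} (h0 : 0 < ξ)
    (h1 : ξ < 1) (x : FrobTuple) (hx : x.IsInj) :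
    tupleMass (z + w).re (tParam z w) ξ x = zLMinor z w ξ x.conf / (x.1 ! : ℝ) ^ 2 := by
  obtain ⟨d, r⟩ := x
  rw [FrobTuple.conf, h.zLMinor_pairConf h0 h1 hx.1 hx.2]
  simp only [Function.comp]
  rw [det_one_div_eq_mul_hookDet, tupleMass, tupleContent, prod_div_distrib,
    prod_mul_distrib, prod_mul_distrib,
    prod_pow, prod_pow]
  simp_rw [h.pochPair_eq, h.pochPair_neg_eq]
  have e : d + ∑ a, r a = ∑ i, (r (.inl i) + r (.inr i) + 1) := by
    rw [Fintype.sum_sum_type, sum_add_distrib, sum_add_distrib]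
    simp [add_comm]
  rw [e]
  have e1 : (∏ i, ((r (.inl i))! : ℝ)) ≠ 0 := prod_ne_zero_iff.2 fun i _ => by positivity
  have e2 : (∏ i, ((r (.inr i))! : ℝ)) ≠ 0 := prod_ne_zero_iff.2 fun i _ => by positivity
  field_simp

theorem AdmissibleParams.hasSum_zLMinor {z w : ℂ} (h : AdmissibleParams z w) {ξ : ℝ} (h0 : 0 < ξ)
    (h1 : ξ < 1) : HasSum (zLMinor z w ξ) ((1 - ξ) ^ (-tParam z w)) := by
  refine hasSum_of_hasSum_tuple (hasSum_tupleMass (s := (z + w).re) h.tParam_pos.le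
    (fun k => ?_) (fun k => ?_) h0 h1)
    (fun x hx => ?_) (fun x hx => h.tupleMass_eq h0 h1 x hx) (fun X hX => ?_)
  · rw [← h.pochPair_eq]; exact (h.pochPair_pos k).le
  · rw [← h.pochPair_neg_eq]; exact (h.neg.pochPair_pos k).le
  · rw [tupleMass, hookDet_of_not_injective _ hx]; simp
  · obtain ⟨d, e, p, q, hp, hq, rfl⟩ := exists_pairConf X
    by_cases hde : d = e
    · subst hde
      exact absurd rfl (hX ⟨d, Sum.elim p q⟩ ⟨hp.injective, hq.injective⟩)
    · exact zLMinor_pairConf_of_ne z w ξ hde hp.injective hq.injective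

theorem AdmissibleParams.zLMinor_nonneg {z w : ℂ} (h : AdmissibleParams z w) {ξ : ℝ} (h0 : 0 < ξ)
    (h1 : ξ < 1) (X : Finset HalfInt) : 0 ≤ zLMinor z w ξ X := by
  obtain ⟨d, e, p, q, hp, hq, rfl⟩ := exists_pairConf X
  by_cases hde : d = e
  · subst hde
    rw [h.zLMinor_pairConf h0 h1 hp.injective hq.injective]
    have := h.tParam_pos
    refine mul_nonneg (mul_nonneg (mul_nonneg (by positivity) (prod_nonneg fun i _ => ?_))
      (sq_nonneg _)) (by positivity)
    have := h.pochPair_pos (p i)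
    have := h.neg.pochPair_pos (q i)
    positivity
  · exact (zLMinor_pairConf_of_ne z w ξ hde hp.injective hq.injective).ge

/-! ### Frobenius coordinates -/

theorem diag_mem_iff_lt_diagLen (μ : YoungDiagram) (i : ℕ) : (i, i) ∈ μ ↔ i < diagLen μ := by
  have hdown : ∀ i, (i, i) ∈ μ → ∀ j ≤ i, (j, j) ∈ μ := fun i hi j hj => μ.up_left_mem hj hj hi
  have hcard : diagLen μ = ((range (μ.card + 1)).filter fun i => (i, i) ∈ μ).card := by
    symm
    refine card_bij (fun i _ => (i, i)) ?_ (fun a _ b _ h => (Prod.ext_iff.1 h).1) ?_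
    · intro i hi
      simp only [mem_filter] at hi ⊢
      exact ⟨hi.2, trivial⟩
    · rintro ⟨a, b⟩ h
      simp only [mem_filter] at h
      obtain ⟨h, rfl⟩ := h
      refine ⟨a, ?_, rfl⟩
      simp only [mem_filter, mem_range]
      refine ⟨?_, h⟩
      have hsub : (range (a + 1)).image (fun i => (i, i)) ⊆ μ.cells := by
        intro c hc
        simp only [mem_image, mem_range] at hc
        obtain ⟨i, hi, rfl⟩ := hc
        exact hdown a h i (by omega)
      have := card_le_card hsub
      rw [card_image_of_injective _ (fun a b h => (Prod.ext_iff.1 h).1), card_range] at this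
      change _ ≤ μ.card at this
      omega
  have hbound : ∀ i, (i, i) ∈ μ → i + 1 ≤ diagLen μ := by
    intro a h
    have hsub : (range (a + 1)).image (fun i => (i, i)) ⊆ μ.cells.filter fun c => c.1 = c.2 := by
      intro c hc
      simp only [mem_image, mem_range] at hc
      obtain ⟨i, hi, rfl⟩ := hc
      simp only [mem_filter]
      exact ⟨hdown a h i (by omega), trivial⟩
    have := card_le_card hsub
    rwa [card_image_of_injective _ (fun a b h => (Prod.ext_iff.1 h).1), card_range] at this
  refine ⟨fun h => hbound i h, fun h => ?_⟩
  by_contra hn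
  have hsub : ((range (μ.card + 1)).filter fun i => (i, i) ∈ μ) ⊆ range i := by
    intro j hj
    simp only [mem_filter, mem_range] at hj ⊢
    by_contra hij
    exact hn (hdown j hj.2 i (by omega))
  have := card_le_card hsub
  rw [← hcard, card_range] at this
  omega

theorem lt_rowLen_diag (μ : YoungDiagram) (i : Fin (diagLen μ)) : (i : ℕ) < μ.rowLen i :=
  YoungDiagram.mem_iff_lt_rowLen.1 ((diag_mem_iff_lt_diagLen μ i).2 i.2)

theorem lt_colLen_diag (μ : YoungDiagram) (i : Fin (diagLen μ)) : (i : ℕ) < μ.colLen i :=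
  YoungDiagram.mem_iff_lt_colLen.1 ((diag_mem_iff_lt_diagLen μ i).2 i.2)

theorem frobP_strictAnti (μ : YoungDiagram) : StrictAnti (frobP μ) := by
  intro i j hij
  have h1 := lt_rowLen_diag μ i
  have h2 := lt_rowLen_diag μ j
  have h3 := μ.rowLen_anti i j (by exact hij.le)
  have h4 : (i : ℕ) < j := hij
  simp only [frobP]
  omega

theorem frobQ_strictAnti (μ : YoungDiagram) : StrictAnti (frobQ μ) := by
  intro i j hij
  have h1 := lt_colLen_diag μ i
  have h2 := lt_colLen_diag μ j
  have h3 := μ.colLen_anti i j (by exact hij.le)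
  have h4 : (i : ℕ) < j := hij
  simp only [frobQ]
  omega

/-- The box `c` lies in one of the hooks with corner `(i, i)`, arm `p_i` and leg `q_i`. -/
def IsFrobCell {d : ℕ} (p q : Fin d → ℕ) (c : ℕ × ℕ) : Prop :=
  (∃ i : Fin d, c.1 = i ∧ c.1 ≤ c.2 ∧ c.2 ≤ c.1 + p i) ∨
    ∃ j : Fin d, c.2 = j ∧ c.2 ≤ c.1 ∧ c.1 ≤ c.2 + q j

theorem mem_iff_isFrobCell (μ : YoungDiagram) (c : ℕ × ℕ) :
    c ∈ μ ↔ IsFrobCell (frobP μ) (frobQ μ) c := by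
  obtain ⟨a, b⟩ := c
  constructor
  · intro h
    rcases le_total a b with hab | hab
    · have hd := (diag_mem_iff_lt_diagLen μ a).1 (μ.up_left_mem le_rfl hab h)
      refine .inl ⟨⟨a, hd⟩, rfl, hab, ?_⟩
      have := YoungDiagram.mem_iff_lt_rowLen.1 h
      simp only [frobP]
      omega
    · have hd := (diag_mem_iff_lt_diagLen μ b).1 (μ.up_left_mem hab le_rfl h)
      refine .inr ⟨⟨b, hd⟩, rfl, hab, ?_⟩
      have := YoungDiagram.mem_iff_lt_colLen.1 h
      simp only [frobQ]
      omega
  · rintro (⟨i, h1, h2, h3⟩ | ⟨i, h1, h2, h3⟩) <;> simp only at h1 h2 h3 <;> subst h1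
    · have := lt_rowLen_diag μ i
      simp only [frobP] at h3
      exact YoungDiagram.mem_iff_lt_rowLen.2 (by omega)
    · have := lt_colLen_diag μ i
      simp only [frobQ] at h3
      exact YoungDiagram.mem_iff_lt_colLen.2 (by omega)

theorem StrictAnti.eq_of_range_eq {d e : ℕ} {p : Fin d → ℕ} {p' : Fin e → ℕ} (hp : StrictAnti p)
    (hp' : StrictAnti p') (h : Set.range p = Set.range p') :
    ∃ hde : e = d, p' = p ∘ Fin.cast hde := by
  obtain ⟨σ, hσ⟩ := exists_perm_of_range_eq hp.injective hp'.injective h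
  obtain rfl : e = d := by simpa using Fintype.card_congr σ
  exact ⟨rfl, hp'.range_inj hp |>.1 h.symm⟩

theorem frobConf_injective : Function.Injective frobConf := by
  intro μ ν h
  have h' := pairConf_eq_iff.1 (show pairConf (frobP μ) (frobQ μ) = pairConf (frobP ν) (frobQ ν)
    from h)
  obtain ⟨hd, h1⟩ := (frobP_strictAnti μ).eq_of_range_eq (frobP_strictAnti ν) h'.1
  obtain ⟨_, h2⟩ := (frobQ_strictAnti μ).eq_of_range_eq (frobQ_strictAnti ν) h'.2
  ext c
  rw [YoungDiagram.mem_cells, YoungDiagram.mem_cells, mem_iff_isFrobCell, mem_iff_isFrobCell,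
    h1, h2]
  change _ ↔ IsFrobCell (_ ∘ Fin.cast hd) (_ ∘ Fin.cast hd) c
  clear h1 h2 h' h
  generalize frobP μ = p
  generalize frobQ μ = q
  revert hd p q
  generalize diagLen μ = d
  intro hd p q
  subst hd
  rfl

/-- The column in which the arm ends weakly decreases from row to row. -/
theorem StrictAnti.add_val_le {d : ℕ} {p : Fin d → ℕ} (hp : StrictAnti p) {i j : Fin d}
    (hij : i ≤ j) : p j + j ≤ p i + i := by
  obtain ⟨n, hn⟩ : ∃ n, (j : ℕ) = i + n := Nat.exists_eq_add_of_le hij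
  induction n generalizing j with
  | zero =>
    obtain rfl : j = i := Fin.ext hn
    exact le_rfl
  | succ n ih =>
    have hlt : (i : ℕ) + n < d := by omega
    have h1 := ih (j := ⟨i + n, hlt⟩) (by rw [Fin.le_def]; simp) rfl
    have h2 := hp (show (⟨i + n, hlt⟩ : Fin d) < j by rw [Fin.lt_def]; simp; omega)
    simp only at h1
    omega

theorem IsFrobCell.swap {d : ℕ} {p q : Fin d → ℕ} {c : ℕ × ℕ} (h : IsFrobCell p q c) :
    IsFrobCell q p c.swap := Or.symm h

theorem IsFrobCell.lower {d : ℕ} {p q : Fin d → ℕ} (hp : StrictAnti p) (hq : StrictAnti q)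
    {a b a' b' : ℕ} (ha : a' ≤ a) (hb : b' ≤ b) (h : IsFrobCell p q (a, b)) :
    IsFrobCell p q (a', b') := by
  wlog h1 : ∃ i : Fin d, a = i ∧ a ≤ b ∧ b ≤ a + p i generalizing p q a b a' b'
  · exact (this hq hp hb ha h.swap (h.resolve_left h1)).swap
  obtain ⟨i, rfl, h2, h3⟩ := h1
  rcases le_or_gt a' b' with hab | hab
  · have := hp.add_val_le (i := ⟨a', by omega⟩) (j := i) ha
    simp only at this
    exact .inl ⟨⟨a', by omega⟩, rfl, hab, by simp only; omega⟩
  · have := hq.add_val_le (i := ⟨b', by omega⟩) (j := i) (by rw [Fin.le_def]; simp only; omega)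
    simp only at this
    exact .inr ⟨⟨b', by omega⟩, rfl, hab.le, by simp only; omega⟩

theorem IsFrobCell.bound {d : ℕ} {p q : Fin d → ℕ} {c : ℕ × ℕ} (h : IsFrobCell p q c) :
    c ∈ range (d + ∑ i, p i + ∑ i, q i) ×ˢ range (d + ∑ i, p i + ∑ i, q i) := by
  rw [mem_product, mem_range, mem_range]
  rcases h with ⟨i, h1, h2, h3⟩ | ⟨i, h1, h2, h3⟩
  · have := single_le_sum (f := p) (fun _ _ => Nat.zero_le _) (mem_univ i)
    omega
  · have := single_le_sum (f := q) (fun _ _ => Nat.zero_le _) (mem_univ i)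
    omega

open Classical in
/-- The Young diagram with Frobenius coordinates `p`, `q`. -/
def frobDiagram {d : ℕ} {p q : Fin d → ℕ} (hp : StrictAnti p) (hq : StrictAnti q) :
    YoungDiagram where
  cells := (range (d + ∑ i, p i + ∑ i, q i) ×ˢ range (d + ∑ i, p i + ∑ i, q i)).filter
    (IsFrobCell p q)
  isLowerSet := by
    rintro ⟨a, b⟩ ⟨a', b'⟩ hle h
    simp only [coe_filter, Set.mem_ofPred_eq] at h ⊢
    have := h.2.lower hp hq hle.1 hle.2
    exact ⟨this.bound, this⟩

open Classical in
theorem mem_frobDiagram {d : ℕ} {p q : Fin d → ℕ} (hp : StrictAnti p) (hq : StrictAnti q)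
    (c : ℕ × ℕ) : c ∈ frobDiagram hp hq ↔ IsFrobCell p q c := by
  rw [← YoungDiagram.mem_cells, frobDiagram, mem_filter]
  exact ⟨fun h => h.2, fun h => ⟨h.bound, h⟩⟩

theorem exists_frobConf_eq {d : ℕ} {p q : Fin d → ℕ} (hp : StrictAnti p) (hq : StrictAnti q) :
    ∃ μ, frobConf μ = pairConf p q := by
  refine ⟨frobDiagram hp hq, ?_⟩
  have hmem := mem_frobDiagram hp hq
  set μ := frobDiagram hp hq
  have hd : ∀ i, i < diagLen μ ↔ i < d := by
    intro i
    rw [← diag_mem_iff_lt_diagLen, hmem]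
    constructor
    · rintro (⟨j, h, -⟩ | ⟨j, h, -⟩) <;> simp only at h <;> omega
    · exact fun h => .inl ⟨⟨i, h⟩, rfl, le_rfl, by simp⟩
  have hrow : ∀ i : Fin d, μ.rowLen i = i + p i + 1 := by
    intro i
    refine eq_of_forall_lt_iff fun b => ?_
    rw [← YoungDiagram.mem_iff_lt_rowLen, hmem]
    constructor
    · rintro (⟨j, h1, h2, h3⟩ | ⟨j, h1, h2, h3⟩) <;> simp only at h1 h2 h3
      · obtain rfl := Fin.ext h1
        omega
      · omega
    · intro h
      have h1 : IsFrobCell p q ((i : ℕ), i + p i) := .inl ⟨i, rfl, by simp, le_rfl⟩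
      exact h1.lower hp hq le_rfl (by omega)
  have hcol : ∀ i : Fin d, μ.colLen i = i + q i + 1 := by
    intro i
    refine eq_of_forall_lt_iff fun b => ?_
    rw [← YoungDiagram.mem_iff_lt_colLen, hmem]
    constructor
    · rintro (⟨j, h1, h2, h3⟩ | ⟨j, h1, h2, h3⟩) <;> simp only at h1 h2 h3
      · omega
      · obtain rfl := Fin.ext h1
        omega
    · intro h
      have h1 : IsFrobCell p q (i + q i, (i : ℕ)) := .inr ⟨i, rfl, by simp, le_rfl⟩
      exact h1.lower hp hq (by omega) le_rfl
  refine pairConf_eq_iff.2 ⟨?_, ?_⟩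
  · ext k
    constructor
    · rintro ⟨i, rfl⟩
      have := hrow ⟨i, (hd i).1 i.2⟩
      refine ⟨⟨i, (hd i).1 i.2⟩, ?_⟩
      simp only [frobP] at this ⊢
      omega
    · rintro ⟨i, rfl⟩
      refine ⟨⟨i, (hd i).2 i.2⟩, ?_⟩
      simp only [frobP, hrow]
      omega
  · ext k
    constructor
    · rintro ⟨i, rfl⟩
      have := hcol ⟨i, (hd i).1 i.2⟩
      refine ⟨⟨i, (hd i).1 i.2⟩, ?_⟩
      simp only [frobQ] at this ⊢
      omega
    · rintro ⟨i, rfl⟩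
      refine ⟨⟨i, (hd i).2 i.2⟩, ?_⟩
      simp only [frobQ, hcol]
      omega

theorem card_eq_sum_frob (μ : YoungDiagram) :
    μ.card = ∑ i, (frobP μ i + frobQ μ i + 1) := by
  have h : ∑ i, (frobP μ i + frobQ μ i + 1) =
      ((univ : Finset (Fin (diagLen μ))).sigma fun i =>
        (range (frobP μ i + 1)).disjSum (range (frobQ μ i))).card := by
    rw [card_sigma]
    refine sum_congr rfl fun i _ => ?_
    rw [card_disjSum, card_range, card_range]
    ring
  rw [h]
  symm
  refine card_bij (fun x _ => Sum.elim (fun k => ((x.1 : ℕ), x.1 + k))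
    (fun k => (x.1 + k + 1, (x.1 : ℕ))) x.2) ?_ ?_ ?_
  · rintro ⟨i, k | k⟩ hx
    · have hk : k < frobP μ i + 1 := by simpa using hx
      refine (mem_iff_isFrobCell μ _).2 (.inl ⟨i, rfl, ?_, ?_⟩) <;> simp only [Sum.elim_inl] <;>
        omega
    · have hk : k < frobQ μ i := by simpa using hx
      refine (mem_iff_isFrobCell μ _).2 (.inr ⟨i, rfl, ?_, ?_⟩) <;> simp only [Sum.elim_inr] <;>
        omega
  · rintro ⟨i, k | k⟩ _ ⟨j, l | l⟩ _ he <;>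
      simp only [Sum.elim_inl, Sum.elim_inr, Prod.mk.injEq] at he
    · obtain rfl := Fin.ext he.1
      obtain rfl : k = l := by omega
      rfl
    · omega
    · omega
    · obtain rfl := Fin.ext he.2
      obtain rfl : k = l := by omega
      rfl
  · rintro ⟨a, b⟩ hc
    rcases (mem_iff_isFrobCell μ _).1 hc with ⟨i, h1, h2, h3⟩ | ⟨i, h1, h2, h3⟩ <;>
      simp only at h1 h2 h3 <;> subst h1
    · refine ⟨⟨i, .inl (b - i)⟩, ?_, ?_⟩
      · simp; omega
      · simp; omega
    · rcases h2.eq_or_lt with h2 | h2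
      · refine ⟨⟨i, .inl 0⟩, ?_, ?_⟩
        · simp
        · simp; omega
      · refine ⟨⟨i, .inr (a - i - 1)⟩, ?_, ?_⟩
        · simp; omega
        · simp; omega

/-! ### Trace class operators with summable matrix entries -/

theorem exists_hasSum_inner_smul {H κ : Type*} [NormedAddCommGroup H] [InnerProductSpace ℂ H]
    [CompleteSpace H] (u v : κ → H) (h : Summable fun k => ‖u k‖ * ‖v k‖) :
    ∃ T : H →L[ℂ] H, ∀ f, HasSum (fun k => inner ℂ (v k) f • u k) (T f) := by
  have hT : Summable fun k => (innerSL ℂ (v k)).smulRight (u k) := by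
    refine Summable.of_norm_bounded h fun k => ?_
    rw [ContinuousLinearMap.norm_smulRight_apply, innerSL_apply_norm, mul_comm]
  refine ⟨∑' k, (innerSL ℂ (v k)).smulRight (u k), fun f => ?_⟩
  have := hT.hasSum.mapL (ContinuousLinearMap.apply ℂ H f)
  simpa using this

theorem opEntry_eq_of_hasSum {S : Type*} [DecidableEq S] (A : S → S → ℂ)
    (L : ℓ²(S, ℂ) →L[ℂ] ℓ²(S, ℂ))
    (hL : ∀ f, HasSum (fun x : S × S => inner ℂ (lp.single 2 x.2 (1 : ℂ) : ℓ²(S, ℂ)) f •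
      (A x.1 x.2 • (lp.single 2 x.1 (1 : ℂ) : ℓ²(S, ℂ)))) (L f)) (a b : S) :
    opEntry L a b = A a b := by
  have h1 := (hL (lp.single 2 b 1)).mapL (lp.evalCLM ℂ (fun _ : S => ℂ) 2 a)
  refine h1.unique ?_
  convert hasSum_single (a, b) ?_ using 1
  · simp [lp.evalCLM]
  · rintro ⟨a', b'⟩ hne
    by_cases hb : b = b'
    · have ha : a ≠ a' := fun ha => hne (by rw [ha, hb])
      simp [lp.evalCLM, ha]
    · simp [lp.evalCLM, lp.inner_single_left, Ne.symm hb]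

theorem exists_isTraceClass_opEntry_eq {S : Type*} [DecidableEq S] [Infinite S] [Countable S]
    (A : S → S → ℂ) (hA : Summable fun x : S × S => ‖A x.1 x.2‖) :
    ∃ L : ℓ²(S, ℂ) →L[ℂ] ℓ²(S, ℂ), IsTraceClass L ∧ ∀ x y, opEntry L x y = A x y := by
  obtain ⟨_⟩ : Nonempty (Denumerable (S × S)) := nonempty_denumerable _
  have e : ℕ ≃ S × S := (Denumerable.eqv _).symm
  have hv : ∀ y, ‖(lp.single 2 y (1 : ℂ) : ℓ²(S, ℂ))‖ = 1 := fun y => by simp [lp.norm_single]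
  have hsum : Summable fun x : S × S => ‖A x.1 x.2 • (lp.single 2 x.1 (1 : ℂ) : ℓ²(S, ℂ))‖ *
      ‖(lp.single 2 x.2 (1 : ℂ) : ℓ²(S, ℂ))‖ := by
    simpa only [norm_smul, hv, mul_one] using hA
  obtain ⟨L, hL⟩ := exists_hasSum_inner_smul _ _ hsum
  refine ⟨L, ⟨fun n => A (e n).1 (e n).2 • lp.single 2 (e n).1 1, fun n => lp.single 2 (e n).2 1,
    ?_, fun f => ?_⟩, fun a b => opEntry_eq_of_hasSum A L hL a b⟩
  · have := hsum.comp_injective e.injective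
    exact this
  · have := e.hasSum_iff.2 (hL f)
    exact this

/-- The ratio test: the quotient of consecutive weights tends to `ξ`. -/
theorem AdmissibleParams.summable_sqrt_psiWeight {z w : ℂ} (h : AdmissibleParams z w) {ξ : ℝ}
    (h0 : 0 < ξ) (h1 : ξ < 1) : Summable fun k => √(psiWeight z w ξ k) := by
  refine summable_of_ratio_test_tendsto_lt_one (l := √ξ)
    ((Real.sqrt_lt' one_pos).2 (by simpa using h1))
    (Filter.Eventually.of_forall fun k => (Real.sqrt_pos.2 (h.psiWeight_pos h0 h1 k)).ne') ?_
  have e : ∀ k : ℕ, ‖√(psiWeight z w ξ (k + 1))‖ / ‖√(psiWeight z w ξ k)‖ =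
      √(ξ * (1 + (z + w).re * (1 / ((k : ℝ) + 1)) +
        tParam z w * (1 / ((k : ℝ) + 1)) ^ 2)) := by
    intro k
    rw [Real.norm_of_nonneg (Real.sqrt_nonneg _), Real.norm_of_nonneg (Real.sqrt_nonneg _),
      ← Real.sqrt_div (h.psiWeight_pos h0 h1 _).le]
    congr 1
    rw [div_eq_iff (h.psiWeight_pos h0 h1 _).ne', psiWeight, psiWeight, h.pochPair_eq,
      h.pochPair_eq, contentProd_succ, Nat.factorial_succ]
    push_cast
    rw [show (k : ℝ) + 1 + 1 / 2 = (k + 1 / 2) + 1 by ring, Real.rpow_add_one h0.ne']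
    have : (k : ℝ) + 1 ≠ 0 := by positivity
    field_simp
  simp_rw [e]
  have hlim := tendsto_one_div_add_atTop_nhds_zero_nat (𝕜 := ℝ)
  have h2 := ((hlim.const_mul (z + w).re).const_add 1).add ((hlim.pow 2).const_mul (tParam z w))
  have h3 := (h2.const_mul ξ).sqrt
  simpa using h3

theorem summable_of_summable_inl_inr {α β : Type*} {f : α ⊕ β → ℝ}
    (h1 : Summable fun a => f (.inl a)) (h2 : Summable fun b => f (.inr b)) : Summable f :=
  (((Sum.inl_injective.hasSum_range_iff).2 h1.hasSum).add_isCompl Set.isCompl_range_inl_range_inr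
    ((Sum.inr_injective.hasSum_range_iff).2 h2.hasSum)).summable

theorem AdmissibleParams.summable_zLMatrix {z w : ℂ} (h : AdmissibleParams z w) {ξ : ℝ}
    (h0 : 0 < ξ) (h1 : ξ < 1) :
    Summable fun x : HalfInt × HalfInt => ‖((zLMatrix z w ξ x.1 x.2 : ℝ) : ℂ)‖ := by
  rw [← (halfIntEquiv.prodCongr halfIntEquiv).summable_iff]
  have hc : Summable (Sum.elim (fun k => √(psiWeight z w ξ k))
      (fun k => √(psiWeight (-z) (-w) ξ k))) :=
    summable_of_summable_inl_inr (h.summable_sqrt_psiWeight h0 h1)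
      (h.neg.summable_sqrt_psiWeight h0 h1)
  have hc0 : ∀ x, 0 ≤ Sum.elim (fun k => √(psiWeight z w ξ k))
      (fun k => √(psiWeight (-z) (-w) ξ k)) x := by
    rintro (k | k) <;> exact Real.sqrt_nonneg _
  have hW : ∀ k l, |wMatrix k l| ≤ 1 := by
    intro k l
    rw [wMatrix, of_apply, abs_of_nonneg (by positivity)]
    refine div_le_one_of_le₀ ?_ (by positivity)
    have : (0 : ℝ) ≤ k := by positivity
    have : (0 : ℝ) ≤ l := by positivity
    linarith
  have hpsi : ∀ k l, |psiWpsi z w ξ k l| ≤ √(psiWeight z w ξ k) * √(psiWeight (-z) (-w) ξ l) := by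
    intro k l
    rw [psiWpsi, of_apply, abs_mul, abs_mul, abs_of_nonneg (Real.sqrt_nonneg _),
      abs_of_nonneg (Real.sqrt_nonneg _)]
    have := mul_le_mul_of_nonneg_left (hW k l) (Real.sqrt_nonneg (psiWeight z w ξ k))
    exact mul_le_mul_of_nonneg_right (by linarith) (Real.sqrt_nonneg _)
  refine Summable.of_nonneg_of_le (fun _ => norm_nonneg _) ?_ (hc.mul_of_nonneg hc hc0 hc0)
  rintro ⟨k | k, l | l⟩ <;> simp [zLMatrix, psiWpsi_neg]
  · positivity
  · exact hpsi k l
  · rw [mul_comm]; exact hpsi l k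
  · positivity

/-! ### The point process and the Fredholm determinant -/

theorem opMinor_eq_det {S : Type*} [DecidableEq S] (L : ℓ²(S, ℂ) →L[ℂ] ℓ²(S, ℂ))
    (K : Matrix S S ℝ) (hL : ∀ x y, opEntry L x y = ((K x y : ℝ) : ℂ)) (X : Finset S) :
    opMinor L X = ((K.submatrix (Subtype.val : X → S) Subtype.val).det : ℝ) := by
  rw [opMinor, ← Complex.ofRealHom_eq_coe, RingHom.map_det]
  congr 1
  ext x y
  simp [hL]

theorem fredholmDet_eq_of_hasSum {S : Type*} [DecidableEq S] {L : ℓ²(S, ℂ) →L[ℂ] ℓ²(S, ℂ)} {D : ℂ}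
    (h : HasSum (opMinor L) D) : fredholmDet L = D := by
  have h' := (Equiv.sigmaFiberEquiv (Finset.card (α := S))).hasSum_iff.2 h
  exact (h'.summable.tsum_sigma.symm.trans h'.tsum_eq)

theorem AdmissibleParams.mixedZMeasure_eq {z w : ℂ} (h : AdmissibleParams z w) {ξ : ℝ}
    (h0 : 0 < ξ) (h1 : ξ < 1) (μ : YoungDiagram) :
    mixedZMeasure z w ξ μ = zLMinor z w ξ (frobConf μ) * (1 - ξ) ^ tParam z w := by
  have hpoch : (ascPochhammer ℝ μ.card).eval (tParam z w) ≠ 0 :=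
    (ascPochhammer_pos _ _ h.tParam_pos).ne'
  change _ = zLMinor z w ξ (pairConf (frobP μ) (frobQ μ)) * _
  rw [h.zLMinor_pairConf h0 h1 (frobP_strictAnti μ).injective (frobQ_strictAnti μ).injective,
    ← card_eq_sum_frob, mixedZMeasure, zMeasure, negBinomial]
  field_simp

theorem AdmissibleParams.zMeasureProcess_eq {z w : ℂ} (h : AdmissibleParams z w) {ξ : ℝ}
    (h0 : 0 < ξ) (h1 : ξ < 1) (X : Finset HalfInt) :
    zMeasureProcess z w ξ X = zLMinor z w ξ X * (1 - ξ) ^ tParam z w := by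
  by_cases hX : ∃ μ, frobConf μ = X
  · obtain ⟨μ, rfl⟩ := hX
    let μ' : {ν // frobConf ν = frobConf μ} := ⟨μ, rfl⟩
    rw [zMeasureProcess, tsum_eq_single μ'
      (fun ν hν => absurd (Subtype.ext (frobConf_injective ν.2)) hν), h.mixedZMeasure_eq h0 h1]
  · have : IsEmpty {μ // frobConf μ = X} := ⟨fun μ => hX ⟨μ.1, μ.2⟩⟩
    obtain ⟨d, e, p, q, hp, hq, rfl⟩ := exists_pairConf X
    have hde : d ≠ e := by
      rintro rfl
      exact hX (exists_frobConf_eq hp hq)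
    rw [zMeasureProcess, tsum_empty, zLMinor_pairConf_of_ne z w ξ hde hp.injective hq.injective,
      zero_mul]

end

theorem proposition3p1 (z z' : ℂ) (hz : AdmissibleParams z z') (ξ : ℝ) (hξ0 : 0 < ξ)
    (hξ1 : ξ < 1) :
    ∃ L : ℓ²(HalfInt, ℂ) →L[ℂ] ℓ²(HalfInt, ℂ),
      (∀ x y : HalfInt, opEntry L x y = ((zLMatrix z z' ξ x y : ℝ) : ℂ)) ∧
      IsDeterminantalProcess (zMeasureProcess z z' ξ) L ∧
      fredholmDet L = (((1 - ξ) ^ (-tParam z z') : ℝ) : ℂ) := by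
  have : Infinite HalfInt := halfIntEquiv.infinite_iff.1 inferInstance
  obtain ⟨L, htr, hL⟩ := exists_isTraceClass_opEntry_eq
    (fun x y => ((zLMatrix z z' ξ x y : ℝ) : ℂ)) (hz.summable_zLMatrix hξ0 hξ1)
  have hminor : ∀ X, opMinor L X = (zLMinor z z' ξ X : ℝ) := opMinor_eq_det L _ hL
  have hξ : 0 < 1 - ξ := by linarith
  have hone : (1 - ξ) ^ (-tParam z z') * (1 - ξ) ^ tParam z z' = 1 := by
    rw [← Real.rpow_add hξ, neg_add_cancel, Real.rpow_zero]
  have hsum := hz.hasSum_zLMinor hξ0 hξ1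
  have hsumC : HasSum (opMinor L) (((1 - ξ) ^ (-tParam z z') : ℝ) : ℂ) := by
    rw [funext hminor]
    exact Complex.hasSum_ofReal.2 hsum
  have hdet := fredholmDet_eq_of_hasSum hsumC
  refine ⟨L, hL, ⟨⟨fun X => ?_, ?_⟩, htr, fun X => ?_, ?_, ?_, fun X => ?_⟩, hdet⟩
  · rw [hz.zMeasureProcess_eq hξ0 hξ1]
    exact mul_nonneg (hz.zLMinor_nonneg hξ0 hξ1 X) (Real.rpow_nonneg hξ.le _)
  · rw [funext (hz.zMeasureProcess_eq hξ0 hξ1)]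
    simpa only [hone] using hsum.mul_right ((1 - ξ) ^ tParam z z')
  · rw [hminor]
    exact ⟨Complex.ofReal_im _, hz.zLMinor_nonneg hξ0 hξ1 X⟩
  · rwa [hdet]
  · rw [hdet]
    exact Complex.ofReal_ne_zero.2 (Real.rpow_pos_of_pos hξ _).ne'
  · rw [hdet, hminor, hz.zMeasureProcess_eq hξ0 hξ1, ← Complex.ofReal_div, Real.rpow_neg hξ.le,
      div_inv_eq_mul]
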